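/- Let $G$ be a finite group, let $n\ge 1$, and let $G_n=G\wr S_n=G^n\rtimes S_n$ be the wreath product, with elements $(g_1,\dots,g_n,\pi)$ and product $(g_1,\dots,g_n,\sigma)(h_1,\dots,h_n,\pi)=(g_1h_{\sigma^{-1}(1)},\dots,g_nh_{\sigma^{-1}(n)},\sigma\pi)$. For $g\in G$ write $g^{(l)}\in G^n\subseteq G_n$ for the element with $g$ in position $l$ and the identity elsewhere, and write $s_i=(i,i+1)\in S_n\subseteq G_n$ for the Coxeter generators, $1\le i\le n-1$. For $1\le m\le n$ let $H_{m,n}=\{(g_1,\dots,g_n,\pi)\in G_n: \pi(j)=j \text{ for } m+1\le j\le n\}$, so that $G^n=H_{1,n}\subseteq\cdots\subseteq H_{n,n}=G_n$, and let $X_i=\sum_{k=1}^{i-1}\sum_{g\in G}(g^{-1})^{(k)}g^{(i)}(k,i)\in\mathbb C[G_n]$, $1\le i\le n$, be the Young-Jucys-Murphy elements. Let $G^\wedge$ be the set of isomorphism classes of finite-dimensional irreducible complex representations of $G$, and let $V^\sigma$ be an irreducible $G$-module in the class $\sigma\in G^\wedge$. Let $V^\lambda$ be a finite-dimensional irreducible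 complex $G_n$-module. A subspace $U\subseteq V^\lambda$ is a GZ-subspace (Gelfand-Tsetlin subspace) if there is a chain of subspaces $U=W_1\subseteq W_2\subseteq\cdots\subseteq W_n=V^\lambda$ such that $W_m$ is an irreducible $H_{m,n}$-submodule for $1\le m\le n$. (The branching from $H_{m,n}$ to $H_{m-1,n}$ is multiplicity free, so the GZ-subspaces are the summands of the canonical decomposition of $V^\lambda$ obtained by restricting successively along the chain.) A GZ-subspace $U$ has weight $\alpha=((\rho_1,\dots,\rho_n),\alpha_1,\dots,\alpha_n)$, with $\rho_l\in G^\wedge$ and $\alpha_l\in\mathbb C$, if $U\cong V^{\rho_1}\otimes\cdots\otimes V^{\rho_n}$ as a $G^n$-module and each $X_l$ acts on $U$ as the scalar $\alpha_l$. If $f:U\to V^{\rho_1}\otimes\cdots\otimes V^{\rho_n}$ is a $G^n$-linear isomorphism and $\rho_i=\rho_{i+1}$, the switch operator is $\tau_{i,U}=f^{-1}\tau_{i,\rho}f:U\to U$, where $\tau_{i,\rho}$ exchanges the $i$-th and $(i+1)$-st tensor factors; it does not depend on $f$. **Theorem.** Let $V_\alpha$ be a GZ-subspace of $V^\lambda$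 with weight $\alpha=((\rho_1,\dots,\rho_n),\alpha_1,\dots,\alpha_n)$. Then: (i) For $1\le i\le n-1$, $s_i V_\alpha=V_\alpha$ if and only if $\rho_i=\rho_{i+1}$ and $\alpha_{i+1}=\alpha_i\pm\frac{|G|}{\dim V^{\rho_i}}$ (for one of the two signs). (ii) For $1\le i\le n-1$: (a) if $\rho_i=\rho_{i+1}$ and $\alpha_{i+1}=\alpha_i+\frac{|G|}{\dim V^{\rho_i}}$, then $s_iv=\tau_{i,V_\alpha}(v)$ for all $v\in V_\alpha$; (b) if $\rho_i=\rho_{i+1}$ and $\alpha_{i+1}=\alpha_i-\frac{|G|}{\dim V^{\rho_i}}$, then $s_iv=-\tau_{i,V_\alpha}(v)$ for all $v\in V_\alpha$. (iii) For $1\le i\le n-1$, if $\rho_i=\rho_{i+1}$ then $\alpha_i\ne\alpha_{i+1}$. (iv) For $1\le i\le n-2$ neither of the following holds: (a) $\rho_i=\rho_{i+1}=\rho_{i+2}$ and $\alpha_i=\alpha_{i+1}+\frac{|G|}{\dim V^{\rho_i}}=\alpha_{i+2}$; (b) $\rho_i=\rho_{i+1}=\rho_{i+2}$ and $\alpha_i=\alpha_{i+1}-\frac{|G|}{\dim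 V^{\rho_i}}=\alpha_{i+2}$. (v) For $1\le i\le n-1$, if $\rho_i\ne\rho_{i+1}$ then $s_iV_\alpha$ is a GZ-subspace of $V^\lambda$ with weight $$s_i\cdot\alpha=((\rho_1,\dots,\rho_{i-1},\rho_{i+1},\rho_i,\rho_{i+2},\dots,\rho_n),\alpha_1,\dots,\alpha_{i-1},\alpha_{i+1},\alpha_i,\alpha_{i+2},\dots,\alpha_n).$$ (vi) For $1\le i\le n-1$, if $\rho_i=\rho_{i+1}$ and $\alpha_{i+1}\ne\alpha_i\pm\frac{|G|}{\dim V^{\rho_i}}$ (for both signs), then $$U=\Bigl(s_i-\frac{|G|}{(\alpha_{i+1}-\alpha_i)\dim V^{\rho_i}}\,\tau_{i,V_\alpha}\Bigr)V_\alpha$$ is a GZ-subspace of $V^\lambda$ with weight $s_i\cdot\alpha=((\rho_1,\dots,\rho_n),\alpha_1,\dots,\alpha_{i-1},\alpha_{i+1},\alpha_i,\alpha_{i+2},\dots,\alpha_n)$. -/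

import Mathlib

open scoped TensorProduct

namespace WreathGZ

noncomputable section

/-! ### The wreath product `G_n = G ≀ S_n` and its chain of subgroups -/

/-- The wreath product `G_n = G ^ n ⋊ S_n`, in which
`(g, σ) * (h, π) = (i ↦ g i * h (σ⁻¹ i), σ * π)`. The indices `1, …, n` are the elements
`0, …, n - 1` of `Fin n`. -/
abbrev Wreath (G : Type*) [Group G] (n : ℕ) : Type _ :=
  SemidirectProduct (Fin n → G) (Equiv.Perm (Fin n)) mulAutArrow

/-- The subgroup `G ^ n` of `G_n`, as an embedding. -/
abbrev base (G : Type*) [Group G] (n : ℕ) : (Fin n → G) →* Wreath G n :=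
  SemidirectProduct.inl

/-- The subgroup `S_n` of `G_n`, as an embedding. -/
abbrev perm (G : Type*) [Group G] (n : ℕ) : Equiv.Perm (Fin n) →* Wreath G n :=
  SemidirectProduct.inr

/-- The subgroup `H_{m,n}` of those `(g, π)` for which `π` fixes all but the first `m` indices.
So `H_{1,n} = G ^ n` and `H_{n,n} = G_n`. -/
def chainSubgroup (G : Type*) [Group G] (n m : ℕ) : Subgroup (Wreath G n) where
  carrier := {x | ∀ j : Fin n, m ≤ (j : ℕ) → x.right j = j}
  mul_mem' := by
    intro x y hx hy j hj
    rw [SemidirectProduct.mul_right, Equiv.Perm.mul_apply, hy j hj, hx j hj]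
  one_mem' := by
    intro j _
    rfl
  inv_mem' := by
    intro x hx j hj
    rw [SemidirectProduct.inv_right, Equiv.Perm.inv_eq_iff_eq]
    exact (hx j hj).symm

/-- The (generalized) Young-Jucys-Murphy element
`X_i = ∑_{k < i} ∑_{g ∈ G} (g⁻¹)^{(k)} g^{(i)} (k, i)` of the group algebra `ℂ[G_n]`. -/
def yjm (G : Type*) [Group G] [Fintype G] (n : ℕ) (i : Fin n) : MonoidAlgebra ℂ (Wreath G n) :=
  ∑ k ∈ Finset.univ.filter (fun k : Fin n => k < i), ∑ g : G,
    MonoidAlgebra.of ℂ (Wreath G n)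
      (base G n (Pi.mulSingle k g⁻¹) * base G n (Pi.mulSingle i g) * perm G n (Equiv.swap k i))

/-! ### Irreducible representations of `G` and of `G ^ n` -/

/-- An irreducible finite-dimensional complex representation of `G`, on some `ℂ ^ d`. -/
structure Irrep (G : Type*) [Group G] where
  /-- The dimension. -/
  dim : ℕ
  /-- The action. -/
  rep : Representation ℂ G (Fin dim → ℂ)
  irreducible : rep.IsIrreducible

/-- Isomorphism of irreducible representations. -/
instance irrepSetoid (G : Type*) [Group G] : Setoid (Irrep G) where
  r A B := Nonempty (A.rep.Equiv B.rep)
  iseqv :=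
    { refl := fun A => ⟨Representation.Equiv.refl A.rep⟩
      symm := fun ⟨e⟩ => ⟨e.symm⟩
      trans := fun ⟨e⟩ ⟨f⟩ => ⟨e.trans f⟩ }

/-- The set `G^∧` of isomorphism classes of irreducible finite-dimensional complex representations
of `G`. -/
abbrev Dual (G : Type*) [Group G] : Type _ := Quotient (irrepSetoid G)

/-- The underlying space of the irreducible `G`-module `V^σ`, for `σ ∈ G^∧`. -/
abbrev irrSpace {G : Type*} [Group G] (σ : Dual G) : Type := Fin σ.out.dim → ℂ

/-- The action of `G` on `V^σ`. -/
abbrev irrRep {G : Type*} [Group G] (σ : Dual G) : Representation ℂ G (irrSpace σ) := σ.out.rep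

/-- The number `|G| / dim V^σ`. -/
def ratio {G : Type*} [Group G] [Fintype G] (σ : Dual G) : ℂ :=
  (Fintype.card G : ℂ) / (Module.finrank ℂ (irrSpace σ) : ℂ)

/-- The space `V^{ρ_1} ⊗ ⋯ ⊗ V^{ρ_n}`. -/
abbrev tensorSpace {G : Type*} [Group G] {n : ℕ} (ρ : Fin n → Dual G) : Type :=
  ⨂[ℂ] j : Fin n, irrSpace (ρ j)

/-- The action of `G ^ n` on `V^{ρ_1} ⊗ ⋯ ⊗ V^{ρ_n}`. -/
def tensorRep {G : Type*} [Group G] {n : ℕ} (ρ : Fin n → Dual G) :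
    Representation ℂ (Fin n → G) (tensorSpace ρ) where
  toFun h := PiTensorProduct.map fun j => irrRep (ρ j) (h j)
  map_one' := by
    simp only [Pi.one_apply, map_one]
    exact PiTensorProduct.map_one
  map_mul' h k := by
    simp only [Pi.mul_apply, map_mul]
    exact PiTensorProduct.map_mul _ _

/-! ### Switch operators -/

theorem label_swap {G : Type*} [Group G] {n : ℕ} {ρ : Fin n → Dual G} {i j : Fin n}
    (h : ρ i = ρ j) (l : Fin n) : ρ ((Equiv.swap i j).symm l) = ρ l := by
  rw [Equiv.symm_swap, Equiv.swap_apply_def]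
  split_ifs with h1 h2
  · rw [h1, h]
  · rw [h2, h]
  · rfl

/-- The identity map between `V^σ` and `V^τ` when `σ = τ`. -/
def irrCast {G : Type*} [Group G] {σ τ : Dual G} (h : σ = τ) : irrSpace σ ≃ₗ[ℂ] irrSpace τ :=
  LinearEquiv.cast (M := irrSpace) h

/-- The operator on `V^{ρ_1} ⊗ ⋯ ⊗ V^{ρ_n}` that switches the `i`-th and the `j`-th factor, when
`ρ_i = ρ_j`. The map `PiTensorProduct.reindex` switches the factors, and its target
`⨂ l, V^{ρ (swap i j l)}` is then identified with `⨂ l, V^{ρ l}` by means of the equalities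
`ρ (swap i j l) = ρ l`. -/
def switch {G : Type*} [Group G] {n : ℕ} (ρ : Fin n → Dual G) (i j : Fin n) (h : ρ i = ρ j) :
    tensorSpace ρ ≃ₗ[ℂ] tensorSpace ρ :=
  (PiTensorProduct.reindex ℂ (fun l => irrSpace (ρ l)) (Equiv.swap i j)).trans
    (PiTensorProduct.congr fun l => irrCast (label_swap h l))

theorem switch_tprod {G : Type*} [Group G] {n : ℕ} (ρ : Fin n → Dual G) (i j : Fin n)
    (h : ρ i = ρ j) (v : ∀ l, irrSpace (ρ l)) :
    switch ρ i j h (PiTensorProduct.tprod ℂ v) =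
      PiTensorProduct.tprod ℂ
        (fun l => irrCast (label_swap h l) (v ((Equiv.swap i j).symm l))) := by
  have h1 := PiTensorProduct.reindex_tprod (R := ℂ) (s := fun l => irrSpace (ρ l))
    (Equiv.swap i j) v
  have h2 := PiTensorProduct.congr_tprod (R := ℂ) (fun l => irrCast (label_swap h l))
    (fun l => v ((Equiv.swap i j).symm l))
  exact (congrArg (PiTensorProduct.congr fun l => irrCast (label_swap h l)) h1).trans h2

section

variable {G : Type*} [Group G] {n : ℕ} {V : Type*} [AddCommGroup V] [Module ℂ V]

/-- A `G ^ n`-linear isomorphism between a subspace `U` of the `G_n`-module `V` and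
`V^{ρ_1} ⊗ ⋯ ⊗ V^{ρ_n}`. The equation says that `U` is closed under `G ^ n` and that the
isomorphism commutes with `G ^ n`. -/
structure LabelIso (R : Representation ℂ (Wreath G n) V) (U : Submodule ℂ V)
    (ρ : Fin n → Dual G) where
  /-- The isomorphism. -/
  equiv : U ≃ₗ[ℂ] tensorSpace ρ
  map_act : ∀ (h : Fin n → G) (t : tensorSpace ρ),
    (equiv.symm (tensorRep ρ h t) : V) = R (base G n h) (equiv.symm t : V)

/-- The switch operator `τ_{i,U} = f⁻¹ τ_{i,ρ} f` on a subspace `U` that is isomorphic to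
`V^{ρ_1} ⊗ ⋯ ⊗ V^{ρ_n}` through `f`, where `ρ_i = ρ_j` (and `j = i + 1`). -/
def LabelIso.switchOn {R : Representation ℂ (Wreath G n) V} {U : Submodule ℂ V}
    {ρ : Fin n → Dual G} (f : LabelIso R U ρ) (i j : Fin n) (h : ρ i = ρ j) : U →ₗ[ℂ] U :=
  ((f.equiv.trans (switch ρ i j h)).trans f.equiv.symm).toLinearMap

/-! ### Gelfand-Tsetlin subspaces and their weights -/

/-- `U` is a Gelfand-Tsetlin subspace of the irreducible `G_n`-module `V`: it is the first term of
a chain `U = W_1 ⊆ W_2 ⊆ ⋯ ⊆ W_n = V`, where `W_m` is an irreducible `H_{m,n}`-submodule. (The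
branching from `H_{m+1,n}` to `H_{m,n}` is multiplicity free, so the irreducible
`H_{m,n}`-submodules of `W_{m+1}` are exactly the summands in its canonical decomposition.) -/
def IsGZSubspace (R : Representation ℂ (Wreath G n) V) (U : Submodule ℂ V) : Prop :=
  ∃ W : (m : ℕ) → Subrepresentation (R.comp (chainSubgroup G n m).subtype),
    (W n).toSubmodule = ⊤ ∧ (W 1).toSubmodule = U ∧
    (∀ m, 1 ≤ m → m ≤ n → (W m).toRepresentation.IsIrreducible) ∧
    ∀ m, 1 ≤ m → m < n → (W m).toSubmodule ≤ (W (m + 1)).toSubmodule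

/-- A tuple `((ρ_1, …, ρ_n), α_1, …, α_n)` with `ρ_l ∈ G^∧` and `α_l ∈ ℂ`. -/
structure Weight (G : Type*) [Group G] (n : ℕ) where
  /-- The label `(ρ_1, …, ρ_n)`. -/
  label : Fin n → Dual G
  /-- The numbers `(α_1, …, α_n)`. -/
  eig : Fin n → ℂ

/-- The tuple with the entries at `i` and `j` exchanged, both in the label and in the numbers. -/
def Weight.swap (α : Weight G n) (i j : Fin n) : Weight G n where
  label l := α.label (Equiv.swap i j l)
  eig l := α.eig (Equiv.swap i j l)

/-- `U` is a Gelfand-Tsetlin subspace of `V` with weight `α`: as a `G ^ n`-module it is isomorphic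
to `V^{ρ_1} ⊗ ⋯ ⊗ V^{ρ_n}`, and `X_l` acts on it as the scalar `α_l`. -/
def HasWeight [Fintype G] (R : Representation ℂ (Wreath G n) V) (U : Submodule ℂ V)
    (α : Weight G n) : Prop :=
  IsGZSubspace R U ∧ Nonempty (LabelIso R U α.label) ∧
    ∀ l : Fin n, ∀ u ∈ U, R.asAlgebraHom (yjm G n l) u = α.eig l • u

/-- The action on `V` of the transposition `(i, j) ∈ S_n`; for `j = i + 1` this is the Coxeter
generator `s_i`. -/
def cox (R : Representation ℂ (Wreath G n) V) (i j : Fin n) : V →ₗ[ℂ] V :=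
  R (perm G n (Equiv.swap i j))

end

end

end WreathGZ

namespace WreathGZ

noncomputable section

/-! ### Twist, class and Jucys-Murphy operators -/

section Operators

variable {G : Type*} [Group G] {n : ℕ}

/-! Everything is governed by the twist operator $T=\sum_g (g^{-1})^{(i)}g^{(i+1)}$. It commutes
with $s_i$ and with every $X_l$, it measures the failure of commutation in $X_{i+1}s_i=s_iX_i+T$
(`jm_succ_mul_cox`), and Schur orthogonality computes it on $V^{\rho_1}\otimes\cdots\otimes
V^{\rho_n}$: it is $0$ if $\rho_i\ne\rho_{i+1}$ (`tensorTwist_eq_zero`), and $r=|G|/\dim V^{\rho_i}$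
times the switch if $\rho_i=\rho_{i+1}$ (`tensorTwist_eq_switch`), so that $T^2=r^2$ in the second
case.

For an invariant inner product $s_i$, $X_l$ and $T$ are self-adjoint. Let $v\in V_\alpha$ be
nonzero, $\rho_i=\rho_{i+1}$, and let $a,b$ be the eigenvalues of $X_i,X_{i+1}$. If $a=b$, then
$Tv=(X_{i+1}-a)s_iv$ is orthogonal to $Tv$, hence zero, against $T^2=r^2$; this is (iii). Otherwise
put $c=1/(b-a)$; then $\|(s_i-cT)v\|^2=(1-c^2r^2)\|v\|^2$ (`inner_intertwiner_of_unitary`). So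
$s_i=cT$ on $V_\alpha$ exactly when $b-a=\pm r$, which yields (ii) and most of (i). If this happens
at $i$ and at $i+1$, the braid relation forces the two differences to be equal, whence (iv).

Parts (v) and (vi) are one statement about $B=s_i-cT$, with $c=0$ when $T=0$
(`HasWeight.map_intertwiner`). $B$ exchanges the two eigenvalues and intertwines the action with its
conjugate by $s_i$; it remains to find a chain for the image. The small terms are replaced by their
images under $B$, the large ones are kept, and the single term in between becomes a joint eigenspace
of $X_{i+1}$ and the class sums at $i+1$. That this eigenspace is irreducible
(`isIrredOn_jointEigen`) is what replaces branching theory; it follows from an orthogonality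
argument on the double cosets of $H_{m-1,n}$ in $H_{m,n}$. -/

theorem perm_mul_base (π : Equiv.Perm (Fin n)) (h : Fin n → G) :
    perm G n π * base G n h = base G n (fun l => h (π⁻¹ l)) * perm G n π := by
  ext
  · simp only [SemidirectProduct.mul_left, SemidirectProduct.left_inr, SemidirectProduct.right_inr,
      SemidirectProduct.left_inl, one_mul, SemidirectProduct.right_inl, map_one, mul_one]
    rfl
  · simp

theorem comp_swap_eq_inv {A : Type*} (h : Fin n → A) (i j : Fin n) :
    (fun l => h ((Equiv.swap i j)⁻¹ l)) = fun l => h (Equiv.swap i j l) := by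
  simp

variable {V : Type*} [AddCommGroup V] [Module ℂ V]

theorem rep_perm_base (R : Representation ℂ (Wreath G n) V) (π : Equiv.Perm (Fin n))
    (h : Fin n → G) :
    R (perm G n π) * R (base G n h) = R (base G n (fun l => h (π⁻¹ l))) * R (perm G n π) := by
  rw [← map_mul, perm_mul_base, map_mul]

theorem cox_mul_base (R : Representation ℂ (Wreath G n) V) (i j : Fin n) (h : Fin n → G) :
    cox R i j * R (base G n h) = R (base G n (fun l => h (Equiv.swap i j l))) * cox R i j := by
  rw [cox, rep_perm_base, comp_swap_eq_inv]

theorem cox_mul_self (R : Representation ℂ (Wreath G n) V) (i j : Fin n) :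
    cox R i j * cox R i j = 1 := by
  rw [cox, ← map_mul, ← map_mul, Equiv.swap_mul_self, map_one, map_one]

theorem cox_cox (R : Representation ℂ (Wreath G n) V) (i j : Fin n) (v : V) :
    cox R i j (cox R i j v) = v :=
  LinearMap.congr_fun (cox_mul_self R i j) v

theorem perm_mul_cox (R : Representation ℂ (Wreath G n) V) (π : Equiv.Perm (Fin n))
    (i j : Fin n) :
    R (perm G n π) * cox R i j = cox R (π i) (π j) * R (perm G n π) := by
  rw [cox, cox, ← map_mul, ← map_mul, ← map_mul, ← map_mul, Equiv.mul_swap_eq_swap_mul]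

theorem rep_eq_base_perm (R : Representation ℂ (Wreath G n) V) (x : Wreath G n) :
    R x = R (base G n x.left) * R (perm G n x.right) := by
  rw [← map_mul, SemidirectProduct.inl_left_mul_inr_right]

variable [Fintype G]

/-- The operator `∑_g (g⁻¹)^{(k)} g^{(l)}`. -/
def twist (R : Representation ℂ (Wreath G n) V) (k l : Fin n) : Module.End ℂ V :=
  ∑ g : G, R (base G n (Pi.mulSingle k g⁻¹ * Pi.mulSingle l g))

/-- The operator `∑_g (g⁻¹ u g)^{(l)}`. -/
def classOp (R : Representation ℂ (Wreath G n) V) (l : Fin n) (u : G) : Module.End ℂ V :=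
  ∑ g : G, R (base G n (Pi.mulSingle l (g⁻¹ * u * g)))

/-- The action of the Young-Jucys-Murphy element `X_l`. -/
def jm (R : Representation ℂ (Wreath G n) V) (l : Fin n) : Module.End ℂ V :=
  R.asAlgebraHom (yjm G n l)

variable (R : Representation ℂ (Wreath G n) V)

theorem jm_eq (l : Fin n) :
    jm R l = ∑ k ∈ Finset.univ.filter (fun k : Fin n => k < l), twist R k l * cox R k l := by
  simp only [jm, yjm, map_sum, twist, cox, Finset.sum_mul]
  refine Finset.sum_congr rfl fun k _ => Finset.sum_congr rfl fun g _ => ?_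
  rw [Representation.asAlgebraHom_of, map_mul, map_mul, map_mul, map_mul]

/-- Substitute $g\mapsto h_k^{-1}gh_l$ in the sum. So the twist moves past $G^n$ exactly as the
transposition $(k,l)$ does; hence their product, and the square of the twist, commute with $G^n$. -/
theorem twist_mul_base {k l : Fin n} (hkl : k ≠ l) (h : Fin n → G) :
    twist R k l * R (base G n h) = R (base G n (fun m => h (Equiv.swap k l m))) * twist R k l := by
  simp only [twist, Finset.sum_mul, Finset.mul_sum, ← map_mul]
  refine Fintype.sum_equiv ((Equiv.mulLeft (h k)⁻¹).trans (Equiv.mulRight (h l))) _ _ fun g => ?_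
  congr 2
  funext m
  rcases eq_or_ne m k with rfl | hk
  · simp [hkl, mul_assoc]
  rcases eq_or_ne m l with rfl | hl
  · simp [hkl.symm, mul_assoc]
  simp [hk, hl, Equiv.swap_apply_of_ne_of_ne]

theorem twist_comm (k l : Fin n) : twist R k l = twist R l k := by
  refine Fintype.sum_equiv (Equiv.inv G) _ _ fun g => ?_
  rcases eq_or_ne k l with rfl | hkl
  · rw [Equiv.inv_apply, inv_inv, ← Pi.mulSingle_mul, ← Pi.mulSingle_mul, inv_mul_cancel,
      mul_inv_cancel]
  have h : Commute (Pi.mulSingle k g⁻¹ : Fin n → G) (Pi.mulSingle l g) :=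
    Pi.mulSingle_commute hkl _ _
  rw [Equiv.inv_apply, inv_inv, h.eq]

theorem perm_mul_twist (π : Equiv.Perm (Fin n)) (k l : Fin n) :
    R (perm G n π) * twist R k l = twist R (π k) (π l) * R (perm G n π) := by
  simp only [twist, Finset.sum_mul, Finset.mul_sum]
  refine Finset.sum_congr rfl fun g _ => ?_
  rw [rep_perm_base]
  congr 3
  funext m
  simp only [Pi.mul_apply, Pi.mulSingle_apply, Equiv.Perm.inv_eq_iff_eq]

theorem cox_mul_twist (i j : Fin n) : cox R i j * twist R i j = twist R i j * cox R i j := by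
  rw [cox, perm_mul_twist, Equiv.swap_apply_left, Equiv.swap_apply_right, twist_comm]

theorem perm_mul_classOp (π : Equiv.Perm (Fin n)) (l : Fin n) (u : G) :
    R (perm G n π) * classOp R l u = classOp R (π l) u * R (perm G n π) := by
  simp only [classOp, Finset.sum_mul, Finset.mul_sum]
  refine Finset.sum_congr rfl fun g _ => ?_
  rw [rep_perm_base]
  congr 3
  funext m
  simp only [Pi.mulSingle_apply, Equiv.Perm.inv_eq_iff_eq]

theorem classOp_commute_base (l : Fin n) (u : G) (h : Fin n → G) :
    Commute (classOp R l u) (R (base G n h)) := by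
  simp only [Commute, SemiconjBy, classOp, Finset.sum_mul, Finset.mul_sum, ← map_mul]
  refine Fintype.sum_equiv (Equiv.mulRight (h l)) _ _ fun g => ?_
  congr 2
  funext m
  rcases eq_or_ne m l with rfl | hm
  · simp [mul_assoc]
  · simp [hm]

theorem classOp_one (l : Fin n) : classOp R l 1 = (Fintype.card G : ℂ) • 1 := by
  simp [classOp, ← Nat.cast_smul_eq_nsmul ℂ]

theorem twistCox_commute_base {k l : Fin n} (hkl : k ≠ l) (h : Fin n → G) :
    Commute (twist R k l * cox R k l) (R (base G n h)) := by
  rw [Commute, SemiconjBy, mul_assoc, cox_mul_base, ← mul_assoc, twist_mul_base R hkl, mul_assoc]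
  simp

theorem perm_mul_twistCox (π : Equiv.Perm (Fin n)) (k l : Fin n) :
    R (perm G n π) * (twist R k l * cox R k l) =
      twist R (π k) (π l) * cox R (π k) (π l) * R (perm G n π) := by
  rw [← mul_assoc, perm_mul_twist, mul_assoc, perm_mul_cox, mul_assoc]

theorem jm_commute_base (l : Fin n) (h : Fin n → G) : Commute (jm R l) (R (base G n h)) := by
  rw [jm_eq]
  refine Commute.sum_left _ _ _ fun k hk => twistCox_commute_base R ?_ h
  exact (Finset.mem_filter.1 hk).2.ne

theorem jm_commute_perm (l : Fin n) (π : Equiv.Perm (Fin n)) (hl : π l = l)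
    (hπ : ∀ k, k < l → π k < l) : Commute (jm R l) (R (perm G n π)) := by
  rw [jm_eq, Commute, SemiconjBy, Finset.sum_mul, Finset.mul_sum]
  have hπ' : ∀ k, π k < l → k < l := by
    have hs : (Finset.univ.filter (fun k : Fin n => k < l)).map π.toEmbedding =
        Finset.univ.filter (fun k : Fin n => k < l) := by
      refine Finset.eq_of_subset_of_card_le ?_ (by simp)
      intro x hx
      simp only [Finset.mem_map, Finset.mem_filter, Finset.mem_univ, true_and] at hx ⊢
      obtain ⟨k, hk, rfl⟩ := hx
      exact hπ k hk
    intro k hk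
    have : π k ∈ (Finset.univ.filter (fun k : Fin n => k < l)).map π.toEmbedding := by
      rw [hs]; simpa using hk
    simpa using this
  symm
  refine Finset.sum_equiv π (fun k => ?_) fun k _ => ?_
  · simpa using ⟨hπ k, hπ' k⟩
  · rw [perm_mul_twistCox, hl]

theorem lt_of_fixes {m : ℕ} {π : Equiv.Perm (Fin n)} (hπ : ∀ j : Fin n, m ≤ (j : ℕ) → π j = j)
    {k : Fin n} (hk : (k : ℕ) < m) : (π k : ℕ) < m := by
  by_contra hc
  have := π.injective (hπ _ (not_lt.1 hc))
  rw [this] at hc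
  exact hc hk

theorem jm_commute_chain {m : ℕ} {l : Fin n} (hl : m ≤ (l : ℕ)) {x : Wreath G n}
    (hx : x ∈ chainSubgroup G n m) : Commute (jm R l) (R x) := by
  rw [rep_eq_base_perm]
  refine (jm_commute_base R l _).mul_right (jm_commute_perm R l _ (hx l hl) fun k hk => ?_)
  rcases lt_or_ge (k : ℕ) m with h | h
  · exact Fin.lt_def.2 ((lt_of_fixes hx h).trans_le hl)
  · rw [hx k h]; exact hk

theorem classOp_commute_chain {m : ℕ} {l : Fin n} (hl : m ≤ (l : ℕ)) (u : G) {x : Wreath G n}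
    (hx : x ∈ chainSubgroup G n m) : Commute (classOp R l u) (R x) := by
  rw [rep_eq_base_perm]
  refine (classOp_commute_base R l u _).mul_right ?_
  rw [Commute, SemiconjBy, perm_mul_classOp, hx l hl]

/-- Conjugation by the transposition carries the terms `k < i` of $X_i$ to those of $X_j$. The
remaining term `k = i` of $X_j$ is $T$ times the transposition, which cancels. -/
theorem jm_succ_mul_cox {i j : Fin n} (hij : (i : ℕ) + 1 = j) :
    jm R j * cox R i j = cox R i j * jm R i + twist R i j := by
  have hlt : i < j := Fin.lt_def.2 (by omega)
  have hset : Finset.univ.filter (fun k : Fin n => k < j) =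
      insert i (Finset.univ.filter (fun k : Fin n => k < i)) := by
    ext k
    simp only [Finset.mem_filter, Finset.mem_univ, true_and, Finset.mem_insert, Fin.lt_def,
      Fin.ext_iff]
    omega
  rw [jm_eq, jm_eq, hset, Finset.sum_insert (by simp), add_mul, mul_assoc, cox_mul_self, mul_one,
    add_comm, Finset.sum_mul, Finset.mul_sum]
  congr 1
  refine Finset.sum_congr rfl fun k hk => ?_
  have hk' : k < i := (Finset.mem_filter.1 hk).2
  conv_rhs => rw [cox, perm_mul_twistCox, Equiv.swap_apply_of_ne_of_ne hk'.ne (hk'.trans hlt).ne,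
    Equiv.swap_apply_left]
  rfl

theorem jm_mul_cox {i j : Fin n} (hij : (i : ℕ) + 1 = j) :
    jm R i * cox R i j = cox R i j * jm R j - twist R i j := by
  have h := congrArg (fun A => cox R i j * A * cox R i j) (jm_succ_mul_cox R hij)
  simp only [mul_add, add_mul] at h
  rw [mul_assoc, mul_assoc, cox_mul_self, mul_one, ← mul_assoc (cox R i j) (cox R i j) (jm R i),
    cox_mul_self, one_mul, cox_mul_twist, mul_assoc, cox_mul_self, mul_one] at h
  exact eq_sub_of_add_eq h.symm

theorem jm_commute_cox {i j l : Fin n} (hij : (i : ℕ) + 1 = j) (hi : l ≠ i) (hj : l ≠ j) :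
    Commute (jm R l) (cox R i j) := by
  refine jm_commute_perm R l _ (Equiv.swap_apply_of_ne_of_ne hi hj) fun k hk => ?_
  rw [Equiv.swap_apply_def]
  simp only [Fin.lt_def, ne_eq, Fin.ext_iff] at *
  split_ifs <;> omega

theorem commute_twist_of_commute_base {A : Module.End ℂ V}
    (hA : ∀ h, Commute A (R (base G n h))) (k l : Fin n) : Commute A (twist R k l) :=
  Commute.sum_right _ _ _ fun _ _ => hA _

theorem twist_mul_twist_swap {k l : Fin n} (hkl : k ≠ l) (p q : Fin n) :
    twist R k l * twist R p q =
      twist R (Equiv.swap k l p) (Equiv.swap k l q) * twist R k l := by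
  have h : ∀ g : G, twist R k l * R (base G n (Pi.mulSingle p g⁻¹ * Pi.mulSingle q g)) =
      R (base G n (Pi.mulSingle (Equiv.swap k l p) g⁻¹ * Pi.mulSingle (Equiv.swap k l q) g)) *
        twist R k l := by
    intro g
    rw [twist_mul_base R hkl]
    congr 3
    funext m
    simp only [Pi.mul_apply, Pi.mulSingle_apply, Equiv.swap_apply_eq_iff]
  conv_lhs => rw [twist.eq_def R p q, Finset.mul_sum]
  conv_rhs => rw [twist.eq_def R (Equiv.swap k l p), Finset.sum_mul]
  exact Finset.sum_congr rfl fun g _ => h g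

theorem twist_mul_twist {k l : Fin n} (hkl : k ≠ l) :
    twist R k l * twist R k l = ∑ u : G, classOp R k u⁻¹ * R (base G n (Pi.mulSingle l u)) := by
  simp only [twist, classOp, Finset.sum_mul, Finset.mul_sum, ← map_mul]
  rw [Finset.sum_comm (s := (Finset.univ : Finset G))]
  conv_rhs => rw [Finset.sum_comm]
  refine Finset.sum_congr rfl fun g _ => Fintype.sum_equiv (Equiv.mulLeft g) _ _ fun x => ?_
  congr 2
  funext m
  rcases eq_or_ne m k with rfl | hk
  · simp [hkl, mul_assoc]
  rcases eq_or_ne m l with rfl | hl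
  · simp [hkl.symm]
  simp [hk, hl]

theorem twist_mul_twist_commute_base {k l : Fin n} (hkl : k ≠ l) (h : Fin n → G) :
    Commute (twist R k l * twist R k l) (R (base G n h)) := by
  rw [Commute, SemiconjBy, mul_assoc, twist_mul_base R hkl, ← mul_assoc, twist_mul_base R hkl]
  simp [mul_assoc]

/-- Writing $C_k(u)$ for the class operators, $T^2=\sum_u C_k(u^{-1})u^{(l)}$. As $T^2$ commutes
with $g^{(l)}$, summing its conjugates over $g$ turns each $u^{(l)}$ into $C_l(u)$. -/
theorem card_smul_twist_twist {k l : Fin n} (hkl : k ≠ l) {χ ψ : G → ℂ} {v : V}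
    (hk : ∀ u, classOp R k u v = χ u • v) (hl : ∀ u, classOp R l u v = ψ u • v) :
    (Fintype.card G : ℂ) • twist R k l (twist R k l v) = (∑ u, χ u⁻¹ * ψ u) • v := by
  have h1 : ∀ g : G, twist R k l (twist R k l v) = ∑ u : G, χ u⁻¹ •
      R (base G n (Pi.mulSingle l (g⁻¹ * u * g))) v := by
    intro g
    have h2 : twist R k l * twist R k l = R (base G n (Pi.mulSingle l g⁻¹)) *
        (twist R k l * twist R k l) * R (base G n (Pi.mulSingle l g)) := by
      rw [mul_assoc, (twist_mul_twist_commute_base R hkl _).eq, ← mul_assoc, ← map_mul, ← map_mul,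
        ← Pi.mulSingle_mul]
      simp
    have h3 := LinearMap.congr_fun h2 v
    rw [twist_mul_twist R hkl] at h3
    rw [← Module.End.mul_apply, twist_mul_twist R hkl, h3, Finset.mul_sum, Finset.sum_mul,
      LinearMap.sum_apply]
    refine Finset.sum_congr rfl fun u _ => ?_
    rw [(classOp_commute_base R k u⁻¹ _).eq, ← mul_assoc, ← map_mul, ← map_mul, mul_assoc,
      (classOp_commute_base R k u⁻¹ _).eq, ← mul_assoc, ← map_mul, ← map_mul,
      Module.End.mul_apply, hk, map_smul, ← Pi.mulSingle_mul, ← Pi.mulSingle_mul]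
  have h4 : (Fintype.card G : ℂ) • twist R k l (twist R k l v) =
      ∑ g : G, twist R k l (twist R k l v) := by
    simp [← Nat.cast_smul_eq_nsmul ℂ]
  rw [h4, Finset.sum_congr rfl fun g _ => h1 g, Finset.sum_comm, Finset.sum_smul]
  refine Finset.sum_congr rfl fun u _ => ?_
  rw [← Finset.smul_sum, mul_smul, ← hl, classOp, LinearMap.sum_apply]

end Operators

/-! ### Irreducible subspaces -/

section Irreducible

variable {Γ : Type*} [Group Γ] {V : Type*} [AddCommGroup V] [Module ℂ V]

/-- The subspace `W` is stable under the subgroup `H`. -/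
def IsStable (R : Representation ℂ Γ V) (H : Subgroup Γ) (W : Submodule ℂ V) : Prop :=
  ∀ h ∈ H, ∀ w ∈ W, R h w ∈ W

/-- The subspace `W` is an irreducible `H`-submodule. -/
structure IsIrredOn (R : Representation ℂ Γ V) (H : Subgroup Γ) (W : Submodule ℂ V) : Prop where
  stable : IsStable R H W
  ne_bot : W ≠ ⊥
  eq_of_le : ∀ U ≤ W, IsStable R H U → U ≠ ⊥ → U = W

/-- A form of Schur's lemma: the kernel of `A` in `W` is `H`-stable and contains `v`.
Semi-commutation through `φ` suffices, so that it also applies to the twist, which does not commute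
with `H`. -/
theorem IsIrredOn.le_ker {R : Representation ℂ Γ V} {H : Subgroup Γ} {W : Submodule ℂ V}
    (hW : IsIrredOn R H W) {A : Module.End ℂ V} (φ : Γ → Γ)
    (hA : ∀ h ∈ H, A * R h = R (φ h) * A) {v : V} (hv : v ∈ W) (hv0 : v ≠ 0) (hAv : A v = 0) :
    ∀ w ∈ W, A w = 0 := by
  have h := hW.eq_of_le (W ⊓ LinearMap.ker A) inf_le_left ?_ ?_
  · intro w hw
    rw [← h] at hw
    exact hw.2
  · intro h hh w hw
    refine ⟨hW.stable h hh w hw.1, ?_⟩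
    have h2 : A (R h w) = R (φ h) (A w) := LinearMap.congr_fun (hA h hh) w
    have h3 : A w = 0 := hw.2
    exact h2.trans (by rw [h3, map_zero])
  · exact fun h0 => hv0 ((Submodule.eq_bot_iff _).1 h0 v ⟨hv, hAv⟩)

theorem IsIrredOn.smul_of_commute {R : Representation ℂ Γ V} {H : Subgroup Γ}
    {W : Submodule ℂ V} (hW : IsIrredOn R H W) {A : Module.End ℂ V} {c : ℂ}
    (hA : ∀ h ∈ H, Commute A (R h)) {v : V} (hv : v ∈ W) (hv0 : v ≠ 0) (hAv : A v = c • v) :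
    ∀ w ∈ W, A w = c • w := by
  have h := hW.le_ker (A := A - c • 1) id (fun h hh => ?_) hv hv0 (by simp [hAv])
  · intro w hw
    simpa [sub_eq_zero] using h w hw
  · rw [sub_mul, mul_sub, id, (hA h hh).eq]
    simp

theorem IsIrredOn.exists_ne_zero {R : Representation ℂ Γ V} {H : Subgroup Γ}
    {W : Submodule ℂ V} (hW : IsIrredOn R H W) : ∃ v ∈ W, v ≠ 0 :=
  Submodule.exists_mem_ne_zero_of_ne_bot hW.ne_bot

/-- The image of an irreducible submodule under an injective map that intertwines up to a bijection
of the subgroup. -/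
theorem IsIrredOn.map {R : Representation ℂ Γ V} {H : Subgroup Γ} {W : Submodule ℂ V}
    (hW : IsIrredOn R H W) {B : Module.End ℂ V} (φ ψ : Γ → Γ) (hφ : ∀ h ∈ H, φ h ∈ H)
    (hψ : ∀ h ∈ H, ψ h ∈ H) (hB : ∀ h ∈ H, R h * B = B * R (φ h))
    (hB' : ∀ h ∈ H, R (ψ h) * B = B * R h)
    (hinj : ∀ w ∈ W, B w = 0 → w = 0) : IsIrredOn R H (W.map B) where
  stable := by
    rintro h hh _ ⟨w, hw, rfl⟩
    exact ⟨R (φ h) w, hW.stable _ (hφ h hh) w hw, (LinearMap.congr_fun (hB h hh) w).symm⟩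
  ne_bot := by
    obtain ⟨v, hv, hv0⟩ := hW.exists_ne_zero
    exact fun h => hv0 (hinj v hv ((Submodule.eq_bot_iff _).1 h _ ⟨v, hv, rfl⟩))
  eq_of_le := by
    intro U hU hst hne
    have h := hW.eq_of_le (W ⊓ U.comap B) inf_le_left ?_ ?_
    · refine le_antisymm hU ?_
      rintro _ ⟨w, hw, rfl⟩
      have hw' : w ∈ W ⊓ U.comap B := by rw [h]; exact hw
      exact hw'.2
    · intro h hh w hw
      refine ⟨hW.stable h hh w hw.1, ?_⟩
      have h2 : R (ψ h) (B w) = B (R h w) := LinearMap.congr_fun (hB' h hh) w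
      have h3 : R (ψ h) (B w) ∈ U := hst _ (hψ h hh) _ hw.2
      rw [h2] at h3
      exact h3
    · obtain ⟨u, hu, hu0⟩ := Submodule.exists_mem_ne_zero_of_ne_bot hne
      obtain ⟨w, hw, rfl⟩ := hU hu
      intro h0
      refine hu0 ?_
      rw [(Submodule.eq_bot_iff _).1 h0 w ⟨hw, hu⟩, map_zero]

theorem isIrredOn_of_isIrreducible {R : Representation ℂ Γ V} {H : Subgroup Γ}
    (W : Subrepresentation (R.comp H.subtype)) (hW : W.toRepresentation.IsIrreducible) :
    IsIrredOn R H W.toSubmodule where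
  stable h hh w hw := W.apply_mem_toSubmodule ⟨h, hh⟩ hw
  ne_bot := by
    intro h0
    obtain ⟨A, B, hAB⟩ := hW.toNontrivial
    refine hAB (Subrepresentation.toSubmodule_injective (Submodule.ext fun x => ?_))
    have hx : x = 0 := Subtype.ext ((Submodule.eq_bot_iff _).1 h0 x x.2)
    simp [hx]
  eq_of_le := by
    intro U hU hst hne
    let U' : Subrepresentation W.toRepresentation :=
      { toSubmodule := U.comap W.toSubmodule.subtype
        apply_mem_toSubmodule := fun g v hv => hst g g.2 _ hv }
    rcases hW.eq_bot_or_eq_top U' with h | h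
    · exfalso
      obtain ⟨u, hu, hu0⟩ := Submodule.exists_mem_ne_zero_of_ne_bot hne
      have h1 : (⟨u, hU hu⟩ : W.toSubmodule) ∈ U'.toSubmodule := hu
      rw [h] at h1
      exact hu0 (congrArg Subtype.val ((Submodule.mem_bot ℂ).1 h1))
    · refine le_antisymm hU fun w hw => ?_
      have h1 : (⟨w, hw⟩ : W.toSubmodule) ∈ U'.toSubmodule := by
        rw [h]; exact Submodule.mem_top
      exact h1

/-- An irreducible `H`-submodule as a subrepresentation. -/
def IsStable.toSubrep {R : Representation ℂ Γ V} {H : Subgroup Γ} {W : Submodule ℂ V}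
    (hW : IsStable R H W) : Subrepresentation (R.comp H.subtype) where
  toSubmodule := W
  apply_mem_toSubmodule g v hv := hW g g.2 v hv

theorem IsIrredOn.isIrreducible {R : Representation ℂ Γ V} {H : Subgroup Γ} {W : Submodule ℂ V}
    (hW : IsIrredOn R H W) : hW.stable.toSubrep.toRepresentation.IsIrreducible where
  exists_pair_ne := by
    refine ⟨⊥, ⊤, fun h => hW.ne_bot ((Submodule.eq_bot_iff _).2 fun w hw => ?_)⟩
    have h1 : (⟨w, hw⟩ : hW.stable.toSubrep.toSubmodule) ∈
        (⊤ : Subrepresentation hW.stable.toSubrep.toRepresentation).toSubmodule :=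
      Submodule.mem_top
    rw [← h] at h1
    exact congrArg Subtype.val ((Submodule.mem_bot ℂ).1 h1)
  eq_bot_or_eq_top := by
    intro U
    rcases eq_or_ne U.toSubmodule ⊥ with h | h
    · exact Or.inl (Subrepresentation.toSubmodule_injective h)
    · right
      have h2 := hW.eq_of_le (U.toSubmodule.map W.subtype) (Submodule.map_subtype_le W _) ?_ ?_
      · refine Subrepresentation.toSubmodule_injective (Submodule.ext fun x => ?_)
        refine ⟨fun _ => Submodule.mem_top, fun _ => ?_⟩
        have hx : (x : V) ∈ U.toSubmodule.map W.subtype := by rw [h2]; exact x.2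
        obtain ⟨y, hy, hyx⟩ := hx
        rwa [← Subtype.ext hyx]
      · rintro g hg _ ⟨u, hu, rfl⟩
        exact ⟨_, U.apply_mem_toSubmodule ⟨g, hg⟩ hu, rfl⟩
      · obtain ⟨u, hu, hu0⟩ := Submodule.exists_mem_ne_zero_of_ne_bot h
        exact fun h0 => hu0 (Subtype.ext ((Submodule.eq_bot_iff _).1 h0 _ ⟨u, hu, rfl⟩))

end Irreducible

/-! ### The subgroup chain and its double cosets. -/

section Chain

variable {G : Type*} [Group G] {n : ℕ} {V : Type*} [AddCommGroup V] [Module ℂ V]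

theorem chainSubgroup_mono {m m' : ℕ} (h : m ≤ m') : chainSubgroup G n m ≤ chainSubgroup G n m' :=
  fun _ hx j hj => hx j (h.trans hj)

theorem base_mem_chainSubgroup (m : ℕ) (h : Fin n → G) : base G n h ∈ chainSubgroup G n m :=
  fun _ _ => rfl

theorem perm_mem_chainSubgroup {m : ℕ} {π : Equiv.Perm (Fin n)}
    (hπ : ∀ j : Fin n, m ≤ (j : ℕ) → π j = j) : perm G n π ∈ chainSubgroup G n m :=
  hπ

/-- A permutation fixing all indices but one is the identity. This serves the case `i = 0`, where
the chain of a GZ-subspace has no term below its first one. -/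
theorem chainSubgroup_zero_eq_one : chainSubgroup G n 0 = chainSubgroup G n 1 := by
  refine le_antisymm (chainSubgroup_mono zero_le_one) fun x hx j _ => ?_
  rcases Nat.eq_zero_or_pos (j : ℕ) with h | h
  · have h1 : (x.right j : ℕ) < 1 := lt_of_fixes hx (by omega)
    exact Fin.ext (by omega)
  · exact hx j h

theorem isGZSubspace_iff (hn : 1 ≤ n) (R : Representation ℂ (Wreath G n) V) (U : Submodule ℂ V) :
    IsGZSubspace R U ↔ ∃ W : ℕ → Submodule ℂ V, W n = ⊤ ∧ W 1 = U ∧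
      (∀ m, 1 ≤ m → m ≤ n → IsIrredOn R (chainSubgroup G n m) (W m)) ∧
      ∀ m, 1 ≤ m → m < n → W m ≤ W (m + 1) := by
  constructor
  · rintro ⟨W, h1, h2, h3, h4⟩
    exact ⟨fun m => (W m).toSubmodule, h1, h2,
      fun m hm hmn => isIrredOn_of_isIrreducible _ (h3 m hm hmn), h4⟩
  · rintro ⟨W, h1, h2, h3, h4⟩
    classical
    -- Terms with `m = 0` or `m > n` are unconstrained; zero is the default where `W m` is not
    -- stable.
    let W' : (m : ℕ) → Subrepresentation (R.comp (chainSubgroup G n m).subtype) := fun m =>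
      if h : IsStable R (chainSubgroup G n m) (W m) then h.toSubrep else ⊥
    have hW' : ∀ m (h : IsStable R (chainSubgroup G n m) (W m)), W' m = h.toSubrep :=
      fun m h => dif_pos h
    have hs : ∀ m, 1 ≤ m → m ≤ n → (W' m).toSubmodule = W m := by
      intro m hm hmn
      rw [hW' m (h3 m hm hmn).stable]
      rfl
    refine ⟨W', by rw [hs n hn le_rfl, h1], by rw [hs 1 le_rfl hn, h2], fun m hm hmn => ?_,
      fun m hm hmn => by rw [hs m hm hmn.le, hs (m + 1) (by omega) hmn]; exact h4 m hm hmn⟩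
    · rw [hW' m (h3 m hm hmn).stable]
      exact (h3 m hm hmn).isIrreducible

/-- The double coset decomposition of `H_{j+1,n}` over `H_{j,n}`. -/
theorem mem_chain_succ {i j : Fin n} (hij : (i : ℕ) + 1 = j) {x : Wreath G n}
    (hx : x ∈ chainSubgroup G n (j + 1)) :
    x ∈ chainSubgroup G n j ∨ ∃ y ∈ chainSubgroup G n j, ∃ z ∈ chainSubgroup G n j,
      x = y * perm G n (Equiv.swap i j) * z := by
  by_cases hj : x.right j = j
  · left
    intro l hl
    rcases hl.eq_or_lt with h | h
    · rw [← Fin.ext h, hj]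
    · exact hx l h
  · right
    have hlt : (x.right j : ℕ) < j := by
      have h1 : (x.right j : ℕ) < j + 1 := lt_of_fixes hx (Nat.lt_succ_self _)
      have h2 : (x.right j : ℕ) ≠ j := fun h => hj (Fin.ext h)
      omega
    set k := x.right j with hk
    have ha : ∀ l : Fin n, (j : ℕ) ≤ l → Equiv.swap k i l = l := by
      intro l hl
      refine Equiv.swap_apply_of_ne_of_ne ?_ ?_ <;> rw [ne_eq, Fin.ext_iff] <;> omega
    -- As `x` sends `j` to `k`, applying $(k,i)$ and then $(i,j)$ brings it back to `j`; so the
    -- rightmost factor fixes `j`.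
    refine ⟨base G n x.left * perm G n (Equiv.swap k i),
      mul_mem (base_mem_chainSubgroup _ _) (perm_mem_chainSubgroup ha),
      perm G n (Equiv.swap i j * (Equiv.swap k i * x.right)), perm_mem_chainSubgroup ?_, ?_⟩
    · intro l hl
      rcases hl.eq_or_lt with h | h
      · rw [← Fin.ext h, Equiv.Perm.mul_apply, Equiv.Perm.mul_apply, ← hk, Equiv.swap_apply_left,
          Equiv.swap_apply_left]
      · rw [Equiv.Perm.mul_apply, Equiv.Perm.mul_apply, hx l h, ha l hl]
        refine Equiv.swap_apply_of_ne_of_ne ?_ ?_ <;> rw [ne_eq, Fin.ext_iff] <;> omega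
    · rw [mul_assoc, mul_assoc, ← map_mul, ← map_mul, Equiv.swap_mul_self_mul,
        Equiv.swap_mul_self_mul, SemidirectProduct.inl_left_mul_inr_right]

theorem cox_mem {R : Representation ℂ (Wreath G n) V} {X : Submodule ℂ V} {m : ℕ}
    (hX : IsStable R (chainSubgroup G n m) X) {i j : Fin n} (hi : (i : ℕ) < m) (hj : (j : ℕ) < m)
    {p : V} (hp : p ∈ X) : cox R i j p ∈ X := by
  refine hX _ (perm_mem_chainSubgroup fun l hl => ?_) _ hp
  refine Equiv.swap_apply_of_ne_of_ne ?_ ?_ <;> rw [ne_eq, Fin.ext_iff] <;> omega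

end Chain

/-! ### Unitary representations -/

section Unitarizable

/-- A finite group acting on a finite-dimensional complex space preserves some inner product. -/
theorem exists_invariant_core {Γ : Type*} [Group Γ] [Finite Γ] {V : Type*} [AddCommGroup V]
    [Module ℂ V] [FiniteDimensional ℂ V] (R : Representation ℂ Γ V) :
    ∃ c : InnerProductSpace.Core ℂ V, ∀ x v w, c.inner (R x v) (R x w) = c.inner v w := by
  have := Fintype.ofFinite Γ
  let e := (Module.finBasis ℂ V).equivFun
  let q : V → V → ℂ := fun v w => ∑ h : Γ, ∑ k, (starRingEnd ℂ) (e (R h v) k) * e (R h w) k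
  have hq : ∀ v, q v v = ((∑ h : Γ, ∑ k, Complex.normSq (e (R h v) k) : ℝ) : ℂ) := by
    intro v
    simp [q, Complex.normSq_eq_conj_mul_self]
  refine ⟨{ inner := q, conj_inner_symm := ?_, re_inner_nonneg := ?_, add_left := ?_,
            smul_left := ?_, definite := ?_ }, ?_⟩
  · intro v w
    simp [q, mul_comm]
  · intro v
    rw [hq]
    simp only [RCLike.re_to_complex, Complex.ofReal_re]
    exact Finset.sum_nonneg fun h _ => Finset.sum_nonneg fun k _ => Complex.normSq_nonneg _
  · intro u v w
    simp [q, add_mul, Finset.sum_add_distrib]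
  · intro v w r
    simp [q, Finset.mul_sum, mul_assoc]
  · intro v hv
    change q v v = 0 at hv
    rw [hq, Complex.ofReal_eq_zero, Finset.sum_eq_zero_iff_of_nonneg fun h _ =>
      Finset.sum_nonneg fun k _ => Complex.normSq_nonneg _] at hv
    have h1 := hv 1 (Finset.mem_univ _)
    rw [Finset.sum_eq_zero_iff_of_nonneg fun k _ => Complex.normSq_nonneg _] at h1
    refine e.map_eq_zero_iff.1 (funext fun k => ?_)
    simpa using h1 k (Finset.mem_univ _)
  · intro x v w
    change q (R x v) (R x w) = q v w
    refine Fintype.sum_equiv (Equiv.mulRight x) _ _ fun h => ?_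
    simp [map_mul]

end Unitarizable

/-! ### Self-adjointness and orthogonality arguments. -/

section Inner

variable {G : Type*} [Group G] {n : ℕ} {V : Type*} [NormedAddCommGroup V] [InnerProductSpace ℂ V]

local notation "⟪" x ", " y "⟫" => inner ℂ x y

theorem inner_rep_left {Γ : Type*} [Group Γ] {R : Representation ℂ Γ V}
    (hU : ∀ x v w, ⟪R x v, R x w⟫ = ⟪v, w⟫) (x : Γ) (v w : V) : ⟪R x v, w⟫ = ⟪v, R x⁻¹ w⟫ := by
  rw [← hU x v, Representation.self_inv_apply]

theorem eq_of_orthogonal [FiniteDimensional ℂ V] {N X : Submodule ℂ V} (h : N ≤ X)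
    (h0 : ∀ p ∈ X, (∀ q ∈ N, ⟪q, p⟫ = 0) → p = 0) : N = X := by
  have h1 := Submodule.sup_orthogonal_inf_of_hasOrthogonalProjection h
  have h2 : Nᗮ ⊓ X = ⊥ := by
    rw [Submodule.eq_bot_iff]
    exact fun p hp => h0 p hp.2 ((Submodule.mem_orthogonal N p).1 hp.1)
  rwa [h2, sup_bot_eq] at h1

variable {R : Representation ℂ (Wreath G n) V} (hU : ∀ x v w, ⟪R x v, R x w⟫ = ⟪v, w⟫)

include hU in
theorem inner_cox (i j : Fin n) (v w : V) : ⟪cox R i j v, w⟫ = ⟪v, cox R i j w⟫ := by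
  rw [cox, inner_rep_left hU, ← map_inv, Equiv.swap_inv]

variable [Fintype G]

include hU in
theorem inner_classOp (l : Fin n) (u : G) (v w : V) :
    ⟪classOp R l u v, w⟫ = ⟪v, classOp R l u⁻¹ w⟫ := by
  simp only [classOp, LinearMap.sum_apply, sum_inner, inner_sum]
  refine Finset.sum_congr rfl fun g _ => ?_
  rw [inner_rep_left hU, ← map_inv, ← Pi.mulSingle_inv]
  simp [mul_assoc]

include hU in
theorem inner_twist {k l : Fin n} (hkl : k ≠ l) (v w : V) :
    ⟪twist R k l v, w⟫ = ⟪v, twist R k l w⟫ := by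
  simp only [twist, LinearMap.sum_apply, sum_inner, inner_sum]
  refine Fintype.sum_equiv (Equiv.inv G) _ _ fun g => ?_
  have h : Commute (Pi.mulSingle k g : Fin n → G) (Pi.mulSingle l g⁻¹) :=
    Pi.mulSingle_commute hkl _ _
  rw [inner_rep_left hU, ← map_inv, mul_inv_rev, ← Pi.mulSingle_inv, ← Pi.mulSingle_inv,
    Equiv.inv_apply, inv_inv, h.eq]

include hU in
theorem inner_jm (l : Fin n) (v w : V) : ⟪jm R l v, w⟫ = ⟪v, jm R l w⟫ := by
  simp only [jm_eq, LinearMap.sum_apply, sum_inner, inner_sum]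
  refine Finset.sum_congr rfl fun k hk => ?_
  have hkl : k ≠ l := (Finset.mem_filter.1 hk).2.ne
  rw [Module.End.mul_apply, inner_twist hU hkl, inner_cox hU, ← Module.End.mul_apply,
    cox_mul_twist]

include hU in
theorem jm_eig_real {l : Fin n} {x : ℂ} {p : V} (hp : p ≠ 0) (hx : jm R l p = x • p) :
    (starRingEnd ℂ) x = x := by
  have h := inner_jm hU l p p
  rw [hx, inner_smul_left, inner_smul_right] at h
  exact mul_right_cancel₀ (inner_self_ne_zero.2 hp) h

include hU in
theorem classOp_eig_conj {l : Fin n} {χ : G → ℂ} {p : V} (hp : p ≠ 0)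
    (hχ : ∀ u, classOp R l u p = χ u • p) (u : G) : (starRingEnd ℂ) (χ u) = χ u⁻¹ := by
  have h := inner_classOp hU l u p p
  rw [hχ, hχ, inner_smul_left, inner_smul_right] at h
  exact mul_right_cancel₀ (inner_self_ne_zero.2 hp) h

include hU in
/-- The twist operator is injective on vectors on which the class operators at the two places
act in the same way. -/
theorem twist_injective_of_unitary {k l : Fin n} (hkl : k ≠ l) {χ : G → ℂ} {p : V}
    (hk : ∀ u, classOp R k u p = χ u • p) (hl : ∀ u, classOp R l u p = χ u • p)
    (hT : twist R k l p = 0) : p = 0 := by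
  by_contra hp
  -- By unitarity $\sum_u\chi(u^{-1})\chi(u)=\sum_u|\chi(u)|^2$, which vanishes only if $\chi(1)=0$;
  -- but the class operator of $1$ is $|G|$.
  have h := card_smul_twist_twist R hkl hk hl
  rw [hT, map_zero, smul_zero] at h
  have h0 := (smul_eq_zero.1 h.symm).resolve_right hp
  have h1 : ∑ u, χ u⁻¹ * χ u = ((∑ u, Complex.normSq (χ u) : ℝ) : ℂ) := by
    rw [Complex.ofReal_sum]
    refine Finset.sum_congr rfl fun u _ => ?_
    rw [← classOp_eig_conj hU hp hk, Complex.normSq_eq_conj_mul_self]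
  rw [h1, Complex.ofReal_eq_zero, Finset.sum_eq_zero_iff_of_nonneg
    fun u _ => Complex.normSq_nonneg _] at h0
  have h2 := Complex.normSq_eq_zero.1 (h0 1 (Finset.mem_univ _))
  have h3 := hk 1
  rw [classOp_one, h2, LinearMap.smul_apply, Module.End.one_apply] at h3
  refine hp ((smul_eq_zero.1 (h3.trans (zero_smul ℂ p))).resolve_left ?_)
  exact Nat.cast_ne_zero.2 Fintype.card_ne_zero

include hU in
/-- If `X_i` and `X_j` agree on `p` and `T p` is an eigenvector of `X_j` then `T p = 0`. -/
theorem twist_eq_zero_of_unitary {i j : Fin n} (hij : (i : ℕ) + 1 = j) {x : ℂ} {p : V}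
    (hp : jm R i p = x • p) (hx : (starRingEnd ℂ) x = x)
    (hT : jm R j (twist R i j p) = x • twist R i j p) : twist R i j p = 0 := by
  -- Thus `T p` lies in the image of the self-adjoint $X_j-x$, while by `hT` it also lies in its
  -- kernel.
  have h1 : twist R i j p = jm R j (cox R i j p) - x • cox R i j p := by
    have h := LinearMap.congr_fun (jm_succ_mul_cox R hij) p
    simp only [Module.End.mul_apply, LinearMap.add_apply, hp, map_smul] at h
    rw [h]; simp
  have h2 : ⟪twist R i j p, twist R i j p⟫ = 0 := by
    nth_rw 2 [h1]
    rw [inner_sub_right, ← inner_jm hU, hT, inner_smul_left, inner_smul_right, hx, sub_self]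
  exact inner_self_eq_zero.1 h2

/-- The part of `Y` on which `X_l` acts as `x` and the class operators at `l` act as `χ`. -/
def jointEigen {V : Type*} [AddCommGroup V] [Module ℂ V] (R : Representation ℂ (Wreath G n) V)
    (Y : Submodule ℂ V) (l : Fin n) (x : ℂ) (χ : G → ℂ) : Submodule ℂ V where
  carrier := {y | y ∈ Y ∧ jm R l y = x • y ∧ ∀ u, classOp R l u y = χ u • y}
  add_mem' := by
    rintro a b ⟨ha, ha', ha''⟩ ⟨hb, hb', hb''⟩
    exact ⟨add_mem ha hb, by rw [map_add, ha', hb', smul_add],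
      fun u => by rw [map_add, ha'', hb'', smul_add]⟩
  zero_mem' := ⟨zero_mem _, by simp, by simp⟩
  smul_mem' := by
    rintro c a ⟨ha, ha', ha''⟩
    exact ⟨Submodule.smul_mem _ _ ha, by rw [map_smul, ha', smul_comm],
      fun u => by rw [map_smul, ha'', smul_comm]⟩

theorem twist_mem {V : Type*} [AddCommGroup V] [Module ℂ V] {R : Representation ℂ (Wreath G n) V}
    {X : Submodule ℂ V} {m : ℕ} (hX : IsStable R (chainSubgroup G n m) X) (k l : Fin n) {p : V}
    (hp : p ∈ X) : twist R k l p ∈ X := by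
  rw [twist, LinearMap.sum_apply]
  exact sum_mem fun g _ => hX _ (base_mem_chainSubgroup m _) _ hp

theorem classOp_mem {V : Type*} [AddCommGroup V] [Module ℂ V]
    {R : Representation ℂ (Wreath G n) V}
    {X : Submodule ℂ V} {m : ℕ} (hX : IsStable R (chainSubgroup G n m) X) (l : Fin n) (u : G)
    {p : V} (hp : p ∈ X) : classOp R l u p ∈ X := by
  rw [classOp, LinearMap.sum_apply]
  exact sum_mem fun g _ => hX _ (base_mem_chainSubgroup m _) _ hp

theorem jm_mem {V : Type*} [AddCommGroup V] [Module ℂ V]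
    {R : Representation ℂ (Wreath G n) V} {X : Submodule ℂ V} {m : ℕ}
    (hX : IsStable R (chainSubgroup G n m) X) {l : Fin n} (hl : (l : ℕ) < m) {p : V}
    (hp : p ∈ X) : jm R l p ∈ X := by
  rw [jm_eq, LinearMap.sum_apply]
  refine sum_mem fun k hk => twist_mem hX _ _ (cox_mem hX ?_ hl hp)
  exact (Fin.lt_def.1 (Finset.mem_filter.1 hk).2).trans hl

include hU in
-- Let `N` be the set of `p ∈ X` with $\langle w,s_ip\rangle=0$. Moving $X_j$ and the class
-- operators at `j` onto `w` shows that $(X_i-x)p$ and $(C_i(u)-\chi(u))p$ lie in `N` for all `p ∈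
-- X`. A vector of `X` orthogonal to `N` is therefore an eigenvector of $X_i$ and $C_i(u)$ with the
-- same eigenvalues as for `j`. The equal Jucys-Murphy eigenvalues make the twist kill it, and the
-- equal class eigenvalues make the twist injective on it, so it is zero and `N = X`.
theorem inner_cox_eq_zero [FiniteDimensional ℂ V] {i j : Fin n} (hij : (i : ℕ) + 1 = j) {x : ℂ}
    {χ : G → ℂ} {X : Submodule ℂ V} (hX : IsStable R (chainSubgroup G n j) X)
    (hXx : ∀ p ∈ X, jm R j p = x • p) (hXχ : ∀ p ∈ X, ∀ u, classOp R j u p = χ u • p)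
    (hx : (starRingEnd ℂ) x = x) (hχ : ∀ u, (starRingEnd ℂ) (χ u) = χ u⁻¹) {w : V}
    (hwx : jm R j w = x • w) (hwχ : ∀ u, classOp R j u w = χ u • w)
    (hw : ∀ p ∈ X, ⟪w, p⟫ = 0) : ∀ p ∈ X, ⟪w, cox R i j p⟫ = 0 := by
  have hi : (i : ℕ) < j := by omega
  have hne : i ≠ j := fun h => by rw [h] at hi; exact lt_irrefl _ hi
  let N : Submodule ℂ V := X ⊓ LinearMap.ker ((innerₛₗ ℂ w).comp (cox R i j))
  have hN : ∀ p, p ∈ N ↔ p ∈ X ∧ ⟪w, cox R i j p⟫ = 0 := fun p => Iff.rfl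
  have hA : ∀ p ∈ X, jm R i p - x • p ∈ N := by
    intro p hp
    rw [hN]
    refine ⟨sub_mem (jm_mem hX hi hp) (X.smul_mem _ hp), ?_⟩
    have h := LinearMap.congr_fun (jm_succ_mul_cox R hij) p
    simp only [Module.End.mul_apply, LinearMap.add_apply] at h
    rw [map_sub, map_smul, eq_sub_of_add_eq h.symm, inner_sub_right, inner_sub_right, ← inner_jm hU,
      hwx, inner_smul_left, inner_smul_right, hx, hw _ (twist_mem hX i j hp)]
    ring
  have hC : ∀ u, ∀ p ∈ X, classOp R i u p - χ u • p ∈ N := by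
    intro u p hp
    rw [hN]
    refine ⟨sub_mem (classOp_mem hX i u hp) (X.smul_mem _ hp), ?_⟩
    have h := LinearMap.congr_fun (perm_mul_classOp R (Equiv.swap i j) i u) p
    rw [Equiv.swap_apply_left] at h
    have h' : cox R i j (classOp R i u p) = classOp R j u (cox R i j p) := h
    have h2 := inner_classOp hU j u⁻¹ w (cox R i j p)
    rw [inv_inv] at h2
    rw [map_sub, map_smul, h', inner_sub_right, ← h2, hwχ, inner_smul_left, inner_smul_right, hχ,
      inv_inv, sub_self]
  have hNX : N = X := by
    refine eq_of_orthogonal inf_le_left fun p hp hpN => ?_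
    -- For $q=(X_i-x)p\in N$ also $(X_i-x)q\in N$, so $\langle
    -- q,q\rangle=\langle(X_i-x)q,p\rangle=0$. The class operators are treated alike, with adjoint
    -- $C_i(u^{-1})$.
    have h1 : jm R i p = x • p := by
      rw [← sub_eq_zero, ← inner_self_eq_zero (𝕜 := ℂ)]
      have hq := hA p hp
      obtain ⟨q, hqp⟩ : ∃ q, q = jm R i p - x • p := ⟨_, rfl⟩
      rw [← hqp] at hq ⊢
      nth_rw 2 [hqp]
      rw [inner_sub_right, inner_smul_right, ← inner_jm hU]
      have h3 := hpN _ (hA q hq.1)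
      rw [inner_sub_left, inner_smul_left, hx] at h3
      exact h3
    have h2 : ∀ u, classOp R i u p = χ u • p := by
      intro u
      rw [← sub_eq_zero, ← inner_self_eq_zero (𝕜 := ℂ)]
      have hq := hC u p hp
      obtain ⟨q, hqp⟩ : ∃ q, q = classOp R i u p - χ u • p := ⟨_, rfl⟩
      rw [← hqp] at hq ⊢
      nth_rw 2 [hqp]
      have h4 := inner_classOp hU i u⁻¹ q p
      rw [inv_inv] at h4
      have h3 := hpN _ (hC u⁻¹ q hq.1)
      rw [inner_sub_left, inner_smul_left, hχ, inv_inv] at h3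
      rw [inner_sub_right, inner_smul_right, ← h4]
      exact h3
    exact twist_injective_of_unitary hU hne h2 (hXχ p hp)
      (twist_eq_zero_of_unitary hU hij h1 hx (hXx _ (twist_mem hX i j hp)))
  intro p hp
  rw [← hNX] at hp
  exact hp.2

include hU in
/-- In an irreducible `H_{j+1,n}`-submodule, the joint eigenspaces of `X_j` and of the class
operators at `j` are irreducible `H_{j,n}`-submodules. -/
theorem isIrredOn_jointEigen_of_unitary [FiniteDimensional ℂ V] {i j : Fin n} (hij : (i : ℕ) + 1 = j)
    {Y : Submodule ℂ V} (hY : IsIrredOn R (chainSubgroup G n (j + 1)) Y) {x : ℂ} {χ : G → ℂ}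
    (hne : jointEigen R Y j x χ ≠ ⊥) :
    IsIrredOn R (chainSubgroup G n j) (jointEigen R Y j x χ) := by
  have hst : IsStable R (chainSubgroup G n j) (jointEigen R Y j x χ) := by
    rintro h hh y ⟨h1, h2, h3⟩
    refine ⟨hY.stable h (chainSubgroup_mono (Nat.le_succ _) hh) y h1, ?_, fun u => ?_⟩
    · have := LinearMap.congr_fun (jm_commute_chain R le_rfl hh).eq y
      rw [Module.End.mul_apply, Module.End.mul_apply, h2, map_smul] at this
      exact this
    · have := LinearMap.congr_fun (classOp_commute_chain R le_rfl u hh).eq y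
      rw [Module.End.mul_apply, Module.End.mul_apply, h3, map_smul] at this
      exact this
  refine ⟨hst, hne, fun X hXD hX hX0 => ?_⟩
  obtain ⟨p₀, hp₀, hp0⟩ := Submodule.exists_mem_ne_zero_of_ne_bot hX0
  have hx := jm_eig_real hU hp0 (hXD hp₀).2.1
  have hχ := classOp_eig_conj hU hp0 (hXD hp₀).2.2
  refine eq_of_orthogonal hXD fun w hw hwX => ?_
  -- Needed for every such `w`, since the left factor `y` of a double coset element is moved onto
  -- `w`.
  have key : ∀ w ∈ jointEigen R Y j x χ, (∀ p ∈ X, ⟪w, p⟫ = 0) →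
      ∀ p ∈ X, ⟪w, cox R i j p⟫ = 0 := fun w hw hwX =>
    inner_cox_eq_zero hU hij hX (fun p hp => (hXD hp).2.1) (fun p hp => (hXD hp).2.2) hx hχ
      hw.2.1 hw.2.2 hwX
  have hwX' : ∀ p ∈ X, ⟪w, p⟫ = 0 := fun p hp => by
    rw [← inner_conj_symm, hwX p hp, map_zero]
  -- The vectors of `Y` whose whole orbit is orthogonal to `w`. By the double coset decomposition
  -- `p₀` is one of them, so irreducibility gives `U = Y`; then `w` lies in `U` and is orthogonal to
  -- itself.
  let U : Submodule ℂ V :=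
    Y ⊓ ⨅ h : chainSubgroup G n (j + 1), LinearMap.ker ((innerₛₗ ℂ w).comp (R h))
  have hUm : ∀ y, y ∈ U ↔ y ∈ Y ∧ ∀ h ∈ chainSubgroup G n (j + 1), ⟪w, R h y⟫ = 0 := by
    intro y
    simp [U]
  have hUY : U = Y := by
    refine hY.eq_of_le U inf_le_left ?_ ?_
    · intro h hh y hy
      rw [hUm] at hy ⊢
      refine ⟨hY.stable h hh y hy.1, fun h' hh' => ?_⟩
      have := hy.2 (h' * h) (mul_mem hh' hh)
      rwa [map_mul, Module.End.mul_apply] at this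
    · intro hbot
      refine hp0 ((Submodule.eq_bot_iff _).1 hbot p₀ ((hUm _).2 ⟨(hXD hp₀).1, fun h hh => ?_⟩))
      rcases mem_chain_succ hij hh with hh | ⟨y, hy, z, hz, rfl⟩
      · exact hwX' _ (hX h hh _ hp₀)
      · rw [map_mul, map_mul, Module.End.mul_apply, Module.End.mul_apply, ← inv_inv y,
          ← inner_rep_left hU]
        refine key _ (hst _ (inv_mem hy) _ hw) (fun p hp => ?_) _ (hX z hz _ hp₀)
        rw [inner_rep_left hU, inv_inv]
        exact hwX' _ (hX y hy _ hp)
  have hwU : w ∈ U := by rw [hUY]; exact hw.1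
  have := ((hUm w).1 hwU).2 1 (one_mem _)
  rw [map_one, Module.End.one_apply] at this
  exact inner_self_eq_zero.1 this

include hU in
/-- The norm of `(s_i - c T) v`, where `c = 1 / (b - a)`. -/
theorem inner_intertwiner_of_unitary {i j : Fin n} (hij : (i : ℕ) + 1 = j) {a b μ : ℂ} {v : V}
    (hv : v ≠ 0) (hi : jm R i v = a • v) (hj : jm R j v = b • v) (hab : b - a ≠ 0)
    (hμ : twist R i j (twist R i j v) = μ • v) :
    ⟪cox R i j v - (b - a)⁻¹ • twist R i j v, cox R i j v - (b - a)⁻¹ • twist R i j v⟫ =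
      (1 - ((b - a)⁻¹) ^ 2 * μ) * ⟪v, v⟫ := by
  have hne : i ≠ j := fun h => by rw [h] at hij; omega
  have ha := jm_eig_real hU hv hi
  have hb := jm_eig_real hU hv hj
  have h1 : ⟪cox R i j v, cox R i j v⟫ = ⟪v, v⟫ := hU _ v v
  have h2 : ⟪twist R i j v, twist R i j v⟫ = μ * ⟪v, v⟫ := by
    rw [inner_twist hU hne, hμ, inner_smul_right]
  have h3 : ⟪cox R i j v, twist R i j v⟫ = ⟪twist R i j v, cox R i j v⟫ := by
    rw [inner_cox hU, inner_twist hU hne, ← Module.End.mul_apply, cox_mul_twist,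
      Module.End.mul_apply]
  -- The cross term comes from evaluating $\langle Tv,X_js_iv\rangle$ twice: with $X_j$ moved to the
  -- left, and with $X_js_iv=a\,s_iv+Tv$.
  have h4 : (b - a) * ⟪twist R i j v, cox R i j v⟫ = ⟪twist R i j v, twist R i j v⟫ := by
    have h := LinearMap.congr_fun (jm_succ_mul_cox R hij) v
    simp only [Module.End.mul_apply, LinearMap.add_apply, hi, map_smul] at h
    have h5 : jm R j (twist R i j v) = b • twist R i j v := by
      have := LinearMap.congr_fun
        (commute_twist_of_commute_base R (jm_commute_base R j) i j).eq v
      rwa [Module.End.mul_apply, Module.End.mul_apply, hj, map_smul] at this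
    have h6 := inner_jm hU j (twist R i j v) (cox R i j v)
    rw [h5, h, inner_add_right, inner_smul_left, inner_smul_right, hb] at h6
    rw [sub_mul, h6]
    ring
  have hc : (starRingEnd ℂ) (b - a)⁻¹ = (b - a)⁻¹ := by rw [map_inv₀, map_sub, ha, hb]
  have h5 : ⟪twist R i j v, cox R i j v⟫ = (b - a)⁻¹ * (μ * ⟪v, v⟫) := by
    rw [← h2, ← h4, inv_mul_cancel_left₀ hab]
  simp only [inner_sub_left, inner_sub_right, inner_smul_left, inner_smul_right, hc, h1, h3, h5, h2]
  ring

end Inner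

/-! ### Transfer to finite-dimensional modules without a chosen inner product. -/

section FiniteDimensional

variable {G : Type*} [Group G] [Fintype G] {n : ℕ} {V : Type*} [AddCommGroup V] [Module ℂ V]
  [FiniteDimensional ℂ V] {R : Representation ℂ (Wreath G n) V}

theorem finite_wreath : Finite (Wreath G n) :=
  Finite.of_equiv _ SemidirectProduct.equivProd.symm

theorem twist_injective {k l : Fin n} (hkl : k ≠ l) {χ : G → ℂ} {p : V}
    (hk : ∀ u, classOp R k u p = χ u • p) (hl : ∀ u, classOp R l u p = χ u • p)
    (hT : twist R k l p = 0) : p = 0 := by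
  have := finite_wreath (G := G) (n := n)
  obtain ⟨c, hc⟩ := exists_invariant_core R
  let := c.toNormedAddCommGroup
  let := InnerProductSpace.ofCore c.toCore
  exact twist_injective_of_unitary (R := R) hc hkl hk hl hT

theorem twist_eq_zero {i j : Fin n} (hij : (i : ℕ) + 1 = j) {x : ℂ} {p : V} (hp0 : p ≠ 0)
    (hi : jm R i p = x • p) (hj : jm R j p = x • p) : twist R i j p = 0 := by
  have := finite_wreath (G := G) (n := n)
  obtain ⟨c, hc⟩ := exists_invariant_core R
  let := c.toNormedAddCommGroup
  let := InnerProductSpace.ofCore c.toCore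
  refine twist_eq_zero_of_unitary (R := R) hc hij hi (jm_eig_real (R := R) hc hp0 hi) ?_
  have h := LinearMap.congr_fun (commute_twist_of_commute_base R (jm_commute_base R j) i j).eq p
  rwa [Module.End.mul_apply, Module.End.mul_apply, hj, map_smul] at h

theorem isIrredOn_jointEigen {i j : Fin n} (hij : (i : ℕ) + 1 = j)
    {Y : Submodule ℂ V} (hY : IsIrredOn R (chainSubgroup G n (j + 1)) Y) {x : ℂ} {χ : G → ℂ}
    (hne : jointEigen R Y j x χ ≠ ⊥) :
    IsIrredOn R (chainSubgroup G n j) (jointEigen R Y j x χ) := by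
  have := finite_wreath (G := G) (n := n)
  obtain ⟨c, hc⟩ := exists_invariant_core R
  let := c.toNormedAddCommGroup
  let := InnerProductSpace.ofCore c.toCore
  exact isIrredOn_jointEigen_of_unitary (R := R) hc hij hY hne

theorem intertwiner_eq_zero_iff {i j : Fin n} (hij : (i : ℕ) + 1 = j) {a b μ : ℂ} {v : V}
    (hv : v ≠ 0) (hi : jm R i v = a • v) (hj : jm R j v = b • v) (hab : b - a ≠ 0)
    (hμ : twist R i j (twist R i j v) = μ • v) :
    cox R i j v - (b - a)⁻¹ • twist R i j v = 0 ↔ (b - a) ^ 2 = μ := by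
  have := finite_wreath (G := G) (n := n)
  obtain ⟨c, hc⟩ := exists_invariant_core R
  let := c.toNormedAddCommGroup
  let := InnerProductSpace.ofCore c.toCore
  have h := inner_intertwiner_of_unitary (R := R) hc hij hv hi hj hab hμ
  have h1 : 1 - ((b - a)⁻¹) ^ 2 * μ = 0 ↔ (b - a) ^ 2 = μ := by
    rw [sub_eq_zero, inv_pow, eq_comm, inv_mul_eq_one₀ (pow_ne_zero 2 hab)]
  rw [← h1]
  constructor
  · intro h0
    rw [h0, inner_zero_left] at h
    exact (mul_eq_zero.1 h.symm).resolve_right (inner_self_ne_zero.2 hv)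
  · intro h0
    rw [h0, zero_mul] at h
    exact inner_self_eq_zero.1 h

end FiniteDimensional

/-! ### Schur's lemma and tensor products -/

section Schur

variable {G : Type*} [Group G] [Fintype G] {V W : Type*} [AddCommGroup V] [Module ℂ V]
  [FiniteDimensional ℂ V] [AddCommGroup W] [Module ℂ W] [FiniteDimensional ℂ W]

/-- The average `∑_g ρ(g⁻¹) A σ(g)` as an intertwining map. -/
def avgMap (ρ : Representation ℂ G V) (σ : Representation ℂ G W) (A : W →ₗ[ℂ] V) :
    Representation.IntertwiningMap σ ρ :=
  LinearMap.intertwiningMap_of_isIntertwiningMap σ ρ (∑ g : G, ρ g⁻¹ ∘ₗ A ∘ₗ σ g) (by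
    intro h v
    simp only [LinearMap.sum_apply, map_sum, LinearMap.comp_apply]
    refine Fintype.sum_equiv (Equiv.mulRight h) _ _ fun g => ?_
    simp [map_mul])

omit [FiniteDimensional ℂ V] [FiniteDimensional ℂ W] in
theorem avgMap_apply (ρ : Representation ℂ G V) (σ : Representation ℂ G W) (A : W →ₗ[ℂ] V)
    (w : W) : avgMap ρ σ A w = ∑ g : G, ρ g⁻¹ (A (σ g w)) := by
  simp [avgMap]

omit [FiniteDimensional ℂ V] [FiniteDimensional ℂ W] in
theorem sum_apply_eq_zero {ρ : Representation ℂ G V} {σ : Representation ℂ G W}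
    (hρ : ρ.IsIrreducible) (hσ : σ.IsIrreducible) (h : IsEmpty (σ.Equiv ρ)) (A : W →ₗ[ℂ] V)
    (w : W) : ∑ g : G, ρ g⁻¹ (A (σ g w)) = 0 := by
  rw [← avgMap_apply, Subsingleton.elim (avgMap ρ σ A) 0]
  rfl

omit [Fintype G] [FiniteDimensional ℂ V] in
theorem nontrivial_of_isIrreducible {ρ : Representation ℂ G V} (hρ : ρ.IsIrreducible) :
    Nontrivial V := by
  by_contra hV
  rw [not_nontrivial_iff_subsingleton] at hV
  obtain ⟨U₁, U₂, hU⟩ := hρ.toNontrivial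
  exact hU (Subrepresentation.toSubmodule_injective (Subsingleton.elim _ _))

/-- The average is an intertwining map, hence a scalar by Schur's lemma; comparing traces finds the
scalar. -/
theorem sum_apply_eq_trace {ρ : Representation ℂ G V} (hρ : ρ.IsIrreducible) (A : V →ₗ[ℂ] V)
    (v : V) : ∑ g : G, ρ g⁻¹ (A (ρ g v)) =
      ((Fintype.card G : ℂ) / (Module.finrank ℂ V : ℂ) * LinearMap.trace ℂ V A) • v := by
  obtain ⟨c, hc⟩ :=
    (Representation.IsIrreducible.algebraMap_intertwiningMap_bijective_of_isAlgClosed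
      (ρ := ρ)).2 (avgMap ρ ρ A)
  have hc' : ∀ v, ∑ g : G, ρ g⁻¹ (A (ρ g v)) = c • v := by
    intro v
    rw [← avgMap_apply, ← hc]
    rfl
  have htr : (Fintype.card G : ℂ) * LinearMap.trace ℂ V A = c * Module.finrank ℂ V := by
    have h1 : ∑ g : G, ρ g⁻¹ * A * ρ g = c • (1 : Module.End ℂ V) := by
      ext v
      simpa [LinearMap.sum_apply] using hc' v
    have h2 := congrArg (LinearMap.trace ℂ V) h1
    rw [map_sum, map_smul, LinearMap.trace_one, smul_eq_mul] at h2
    rw [← h2, Finset.sum_congr rfl fun g _ => ?_, Finset.sum_const, Finset.card_univ,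
      nsmul_eq_mul]
    rw [LinearMap.trace_mul_comm, ← mul_assoc, ← map_mul, mul_inv_cancel, map_one, one_mul]
  have hV := nontrivial_of_isIrreducible hρ
  have hd : (Module.finrank ℂ V : ℂ) ≠ 0 := Nat.cast_ne_zero.2 Module.finrank_pos.ne'
  rw [hc', div_mul_eq_mul_div, htr, mul_div_cancel_right₀ _ hd]

omit [FiniteDimensional ℂ V] in
-- Expanding `σ g b` in a basis $(e_k)$ turns a bilinear sum into averages of the rank-one maps
-- $w\mapsto e_k^*(w)a$, to which Schur's lemma applies.
theorem sum_bilin {M : Type*} [AddCommGroup M] [Module ℂ M] (ρ : Representation ℂ G V)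
    (σ : Representation ℂ G W) (F : V →ₗ[ℂ] W →ₗ[ℂ] M) (a : V) (b : W) :
    ∑ g : G, F (ρ g⁻¹ a) (σ g b) =
      ∑ k, F (∑ g : G, ρ g⁻¹ ((((Module.finBasis ℂ W).coord k).smulRight a) (σ g b)))
        (Module.finBasis ℂ W k) := by
  simp only [map_sum, LinearMap.sum_apply]
  rw [Finset.sum_comm]
  refine Finset.sum_congr rfl fun g _ => ?_
  conv_lhs => rw [← (Module.finBasis ℂ W).sum_repr (σ g b)]
  simp only [map_sum, map_smul, LinearMap.smulRight_apply, LinearMap.smul_apply,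
    Module.Basis.coord_apply]

omit [FiniteDimensional ℂ V] in
theorem sum_bilin_eq_zero {M : Type*} [AddCommGroup M] [Module ℂ M] {ρ : Representation ℂ G V}
    {σ : Representation ℂ G W} (hρ : ρ.IsIrreducible) (hσ : σ.IsIrreducible)
    (h : IsEmpty (σ.Equiv ρ)) (F : V →ₗ[ℂ] W →ₗ[ℂ] M) (a : V) (b : W) :
    ∑ g : G, F (ρ g⁻¹ a) (σ g b) = 0 := by
  rw [sum_bilin]
  simp only [sum_apply_eq_zero hρ hσ h, map_zero, LinearMap.zero_apply, Finset.sum_const_zero]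

/-- The rank-one map $w\mapsto e_k^*(w)a$ has trace $e_k^*(a)$, so the sum over the basis
reassembles `a`, now in the second argument. This is the origin of the switch operator. -/
theorem sum_bilin_eq_flip {M : Type*} [AddCommGroup M] [Module ℂ M] {ρ : Representation ℂ G V}
    (hρ : ρ.IsIrreducible) (F : V →ₗ[ℂ] V →ₗ[ℂ] M) (a b : V) :
    ∑ g : G, F (ρ g⁻¹ a) (ρ g b) =
      ((Fintype.card G : ℂ) / (Module.finrank ℂ V : ℂ)) • F b a := by
  rw [sum_bilin]
  conv_rhs => rw [← (Module.finBasis ℂ V).sum_repr a]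
  simp only [sum_apply_eq_trace hρ, LinearMap.trace_smulRight]
  simp only [map_sum, map_smul, LinearMap.smul_apply, mul_smul, Finset.smul_sum,
    Module.Basis.coord_apply]

end Schur

/-! ### Class sums and twists on tensor products of irreducible modules. -/

section Label

variable {G : Type*} [Group G]

theorem irrCast_irrCast {σ τ υ : Dual G} (h₁ : σ = τ) (h₂ : τ = υ) (v : irrSpace σ) :
    irrCast h₂ (irrCast h₁ v) = irrCast (h₁.trans h₂) v := by
  subst h₁ h₂; rfl

theorem isEmpty_equiv_of_ne {σ τ : Dual G} (h : σ ≠ τ) :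
    IsEmpty ((irrRep τ).Equiv (irrRep σ)) := by
  refine ⟨fun e => h ?_⟩
  rw [← Quotient.out_eq σ, ← Quotient.out_eq τ]
  exact Quotient.sound ⟨e.symm⟩

variable [Fintype G]

theorem ratio_ne_zero (σ : Dual G) : ratio σ ≠ 0 := by
  have := nontrivial_of_isIrreducible σ.out.irreducible
  exact div_ne_zero (Nat.cast_ne_zero.2 Fintype.card_ne_zero)
    (Nat.cast_ne_zero.2 Module.finrank_pos.ne')

theorem sum_irr_bilin_eq_flip {M : Type*} [AddCommGroup M] [Module ℂ M] {σ τ : Dual G}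
    (h : σ = τ) (F : irrSpace σ →ₗ[ℂ] irrSpace τ →ₗ[ℂ] M) (a : irrSpace σ) (b : irrSpace τ) :
    ∑ g : G, F (irrRep σ g⁻¹ a) (irrRep τ g b) =
      ratio σ • F (irrCast h.symm b) (irrCast h a) := by
  subst h
  exact sum_bilin_eq_flip σ.out.irreducible F a b

/-- The scalar by which `∑_g g⁻¹ u g` acts on `V^σ`. -/
def labelChar (σ : Dual G) (u : G) : ℂ :=
  ratio σ * LinearMap.trace ℂ (irrSpace σ) (irrRep σ u)

theorem sum_irr_conj (σ : Dual G) (u : G) (v : irrSpace σ) :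
    ∑ g : G, irrRep σ (g⁻¹ * u * g) v = labelChar σ u • v := by
  have h := sum_apply_eq_trace σ.out.irreducible (irrRep σ u) v
  rw [labelChar, ratio, ← h]
  refine Finset.sum_congr rfl fun g _ => ?_
  rw [map_mul, map_mul]
  rfl

variable {n : ℕ} (ρ : Fin n → Dual G)

omit [Fintype G] in
theorem tensorRep_tprod (h : Fin n → G) (v : ∀ l, irrSpace (ρ l)) :
    tensorRep ρ h (PiTensorProduct.tprod ℂ v) =
      PiTensorProduct.tprod ℂ (fun l => irrRep (ρ l) (h l) (v l)) :=
  PiTensorProduct.map_tprod _ _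

theorem sum_tensorRep_conj (l : Fin n) (u : G) :
    ∑ g : G, tensorRep ρ (Pi.mulSingle l (g⁻¹ * u * g)) = labelChar (ρ l) u • 1 := by
  refine PiTensorProduct.ext (MultilinearMap.ext fun v => ?_)
  simp only [LinearMap.compMultilinearMap_apply, LinearMap.sum_apply, tensorRep_tprod,
    LinearMap.smul_apply, Module.End.one_apply]
  have h : ∀ g : G, (fun m => irrRep (ρ m)
      ((Pi.mulSingle l (g⁻¹ * u * g) : Fin n → G) m) (v m)) =
      Function.update v l (irrRep (ρ l) (g⁻¹ * u * g) (v l)) := by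
    intro g
    funext m
    rcases eq_or_ne m l with rfl | hm
    · simp
    · simp [hm]
  simp only [h]
  have h2 := map_sum ((PiTensorProduct.tprod ℂ).toLinearMap v l)
    (fun g => irrRep (ρ l) (g⁻¹ * u * g) (v l)) Finset.univ
  rw [sum_irr_conj, map_smul] at h2
  simp only [MultilinearMap.toLinearMap_apply, Function.update_eq_self] at h2
  exact h2.symm

/-- `tprod` as a bilinear map in two places. -/
def tprodBilin {k l : Fin n} (hkl : k ≠ l) (v : ∀ m, irrSpace (ρ m)) :
    irrSpace (ρ k) →ₗ[ℂ] irrSpace (ρ l) →ₗ[ℂ] tensorSpace ρ :=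
  LinearMap.mk₂ ℂ
    (fun a b => PiTensorProduct.tprod ℂ (Function.update (Function.update v k a) l b))
    (fun a a' b => by simp only [Function.update_comm hkl, MultilinearMap.map_update_add])
    (fun c a b => by simp only [Function.update_comm hkl, MultilinearMap.map_update_smul])
    (fun a b b' => by simp only [MultilinearMap.map_update_add])
    (fun c a b => by simp only [MultilinearMap.map_update_smul])

/-- The operator `∑_g (g⁻¹)^{(k)} g^{(l)}` on a tensor product. -/
def tensorTwist (k l : Fin n) : Module.End ℂ (tensorSpace ρ) :=
  ∑ g : G, tensorRep ρ (Pi.mulSingle k g⁻¹ * Pi.mulSingle l g)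

theorem tensorTwist_tprod {k l : Fin n} (hkl : k ≠ l) (v : ∀ m, irrSpace (ρ m)) :
    tensorTwist ρ k l (PiTensorProduct.tprod ℂ v) =
      ∑ g : G, tprodBilin ρ hkl v (irrRep (ρ k) g⁻¹ (v k)) (irrRep (ρ l) g (v l)) := by
  rw [tensorTwist, LinearMap.sum_apply]
  refine Finset.sum_congr rfl fun g _ => ?_
  rw [tensorRep_tprod]
  refine congrArg (PiTensorProduct.tprod ℂ) (funext fun m => ?_)
  rcases eq_or_ne m l with rfl | hl
  · simp [hkl.symm]
  rcases eq_or_ne m k with rfl | hk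
  · simp [hkl]
  simp [hk, hl]

theorem tensorTwist_eq_zero {k l : Fin n} (h : ρ k ≠ ρ l) : tensorTwist ρ k l = 0 := by
  refine PiTensorProduct.ext (MultilinearMap.ext fun v => ?_)
  have hkl : k ≠ l := fun hkl => h (congrArg ρ hkl)
  rw [LinearMap.compMultilinearMap_apply, tensorTwist_tprod ρ hkl,
    sum_bilin_eq_zero (ρ k).out.irreducible (ρ l).out.irreducible (isEmpty_equiv_of_ne h)]
  rfl

omit [Fintype G] in
theorem irrCast_index {k m l : Fin n} (v : ∀ m, irrSpace (ρ m)) (h : m = l) (h₁ : ρ m = ρ k)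
    (h₂ : ρ l = ρ k) : irrCast h₁ (v m) = irrCast h₂ (v l) := by
  subst h; rfl

theorem tensorTwist_eq_switch {k l : Fin n} (hkl : k ≠ l) (h : ρ k = ρ l) :
    tensorTwist ρ k l = ratio (ρ k) • (switch ρ k l h).toLinearMap := by
  refine PiTensorProduct.ext (MultilinearMap.ext fun v => ?_)
  rw [LinearMap.compMultilinearMap_apply, LinearMap.compMultilinearMap_apply,
    tensorTwist_tprod ρ hkl, sum_irr_bilin_eq_flip h, LinearMap.smul_apply,
    LinearEquiv.coe_coe, switch_tprod]
  refine congrArg (fun t => ratio (ρ k) • t)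
    (congrArg (PiTensorProduct.tprod ℂ) (funext fun m => ?_))
  rcases eq_or_ne m l with rfl | hl
  · rw [Function.update_self]
    exact (irrCast_index ρ v (by simp) _ _).symm
  rcases eq_or_ne m k with rfl | hk
  · rw [Function.update_of_ne hl, Function.update_self]
    exact (irrCast_index ρ v (by simp) _ _).symm
  · rw [Function.update_of_ne hl, Function.update_of_ne hk]
    refine Eq.trans ?_ (irrCast_index ρ v (l := m) ?_ _ rfl).symm
    · rfl
    · rw [Equiv.symm_swap, Equiv.swap_apply_of_ne_of_ne hk hl]

end Label

/-! ### Transport of these formulas to labelled subspaces. -/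

section LabelIso

variable {G : Type*} [Group G] [Fintype G] {n : ℕ} {V : Type*} [AddCommGroup V] [Module ℂ V]
  {R : Representation ℂ (Wreath G n) V} {U : Submodule ℂ V} {ρ : Fin n → Dual G}
  (f : LabelIso R U ρ)

omit [Fintype G] in
theorem LabelIso.sum_act {ι : Type*} (s : Finset ι) (h : ι → Fin n → G) (t : tensorSpace ρ) :
    (f.equiv.symm ((∑ x ∈ s, tensorRep ρ (h x)) t) : V) =
      (∑ x ∈ s, R (base G n (h x))) (f.equiv.symm t : V) := by
  rw [LinearMap.sum_apply, LinearMap.sum_apply, map_sum, AddSubmonoidClass.coe_finsetSum]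
  exact Finset.sum_congr rfl fun x _ => f.map_act _ _

include f in
theorem LabelIso.classOp_apply (l : Fin n) (u : G) {v : V} (hv : v ∈ U) :
    classOp R l u v = labelChar (ρ l) u • v := by
  have h := f.sum_act Finset.univ (fun g : G => Pi.mulSingle l (g⁻¹ * u * g)) (f.equiv ⟨v, hv⟩)
  rw [sum_tensorRep_conj] at h
  simp only [LinearMap.smul_apply, Module.End.one_apply, map_smul, LinearEquiv.symm_apply_apply,
    Submodule.coe_smul] at h
  exact h.symm

include f in
theorem LabelIso.twist_eq_zero {k l : Fin n} (hkl : ρ k ≠ ρ l) {v : V} (hv : v ∈ U) :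
    twist R k l v = 0 := by
  have h := f.sum_act Finset.univ (fun g : G => Pi.mulSingle k g⁻¹ * Pi.mulSingle l g)
    (f.equiv ⟨v, hv⟩)
  rw [← tensorTwist, tensorTwist_eq_zero ρ hkl] at h
  simp only [LinearMap.zero_apply, map_zero, LinearEquiv.symm_apply_apply,
    Submodule.coe_zero] at h
  exact h.symm

theorem LabelIso.twist_eq_switchOn {k l : Fin n} (hkl : k ≠ l) (h : ρ k = ρ l) (v : U) :
    twist R k l v = ratio (ρ k) • (f.switchOn k l h v : V) := by
  have h1 := f.sum_act Finset.univ (fun g : G => Pi.mulSingle k g⁻¹ * Pi.mulSingle l g)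
    (f.equiv v)
  rw [← tensorTwist, tensorTwist_eq_switch ρ hkl h] at h1
  simp only [LinearMap.smul_apply, map_smul, LinearEquiv.symm_apply_apply,
    Submodule.coe_smul] at h1
  exact h1.symm

end LabelIso

/-! ### The intertwining operator `s_i - c T` -/

section Intertwiner

variable {G : Type*} [Group G] [Fintype G] {n : ℕ} {V : Type*} [AddCommGroup V] [Module ℂ V]

/-- The operator `s_i - c ∑_g (g⁻¹)^{(i)} g^{(j)}`. -/
def intertwiner (R : Representation ℂ (Wreath G n) V) (i j : Fin n) (c : ℂ) : Module.End ℂ V :=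
  cox R i j - c • twist R i j

variable (R : Representation ℂ (Wreath G n) V) {i j : Fin n}

theorem intertwiner_apply (c : ℂ) (v : V) :
    intertwiner R i j c v = cox R i j v - c • twist R i j v := rfl

/-- Conjugation by a transposition. -/
def swapConj (i j : Fin n) (x : Wreath G n) : Wreath G n :=
  perm G n (Equiv.swap i j) * x * perm G n (Equiv.swap i j)

omit [Fintype G] in
theorem swapConj_swapConj (x : Wreath G n) : swapConj i j (swapConj i j x) = x := by
  have h : perm G n (Equiv.swap i j) * perm G n (Equiv.swap i j) = 1 := by
    rw [← map_mul, Equiv.swap_mul_self, map_one]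
  rw [swapConj, swapConj, ← mul_assoc, ← mul_assoc, h, one_mul, mul_assoc, h, mul_one]

omit [Fintype G] in
theorem swapConj_mem {m : ℕ} (hi : m ≤ (i : ℕ)) (hj : m ≤ (j : ℕ)) {x : Wreath G n}
    (hx : x ∈ chainSubgroup G n m) : swapConj i j x ∈ chainSubgroup G n m := by
  intro l hl
  have h : (swapConj i j x).right l = Equiv.swap i j (x.right (Equiv.swap i j l)) := rfl
  rw [h, hx, Equiv.swap_apply_self]
  rw [Equiv.swap_apply_def]
  split_ifs <;> assumption

omit [Fintype G] in
theorem swapConj_base (h : Fin n → G) :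
    swapConj i j (base G n h) = base G n (fun l => h (Equiv.swap i j l)) := by
  rw [swapConj, perm_mul_base, mul_assoc, ← map_mul, Equiv.swap_mul_self, map_one, mul_one,
    comp_swap_eq_inv]

theorem twistCox_commute_chain {m : ℕ} (hij : i ≠ j) (hi : m ≤ (i : ℕ)) (hj : m ≤ (j : ℕ))
    {x : Wreath G n} (hx : x ∈ chainSubgroup G n m) :
    Commute (twist R i j * cox R i j) (R x) := by
  rw [rep_eq_base_perm]
  refine (twistCox_commute_base R hij _).mul_right ?_
  rw [Commute, SemiconjBy, perm_mul_twistCox, hx i hi, hx j hj]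

omit [Fintype G] in
theorem cox_mul_rep (x : Wreath G n) :
    cox R i j * R x = R (swapConj i j x) * cox R i j := by
  rw [swapConj, map_mul, map_mul, mul_assoc _ _ (cox R i j)]
  change cox R i j * R x = cox R i j * R x * (cox R i j * cox R i j)
  rw [cox_mul_self, mul_one]

/-- The product of the twist and the transposition commutes with $H_{m,n}$, whose permutations fix
`i` and `j`; so the twist conjugates $H_{m,n}$ as the transposition does. -/
theorem twist_mul_rep {m : ℕ} (hij : i ≠ j) (hi : m ≤ (i : ℕ)) (hj : m ≤ (j : ℕ))
    {x : Wreath G n} (hx : x ∈ chainSubgroup G n m) :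
    twist R i j * R x = R (swapConj i j x) * twist R i j := by
  have h1 : twist R i j = cox R i j * (twist R i j * cox R i j) := by
    rw [← mul_assoc, cox_mul_twist, mul_assoc, cox_mul_self, mul_one]
  rw [h1, mul_assoc, (twistCox_commute_chain R hij hi hj hx).eq, ← mul_assoc, cox_mul_rep,
    mul_assoc]

theorem intertwiner_mul_rep {m : ℕ} (hij : i ≠ j) (hi : m ≤ (i : ℕ)) (hj : m ≤ (j : ℕ))
    {x : Wreath G n} (hx : x ∈ chainSubgroup G n m) (c : ℂ) :
    intertwiner R i j c * R x = R (swapConj i j x) * intertwiner R i j c := by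
  rw [intertwiner, sub_mul, mul_sub, cox_mul_rep, smul_mul_assoc, twist_mul_rep R hij hi hj hx,
    mul_smul_comm]

theorem intertwiner_mul_base (hij : i ≠ j) (c : ℂ) (h : Fin n → G) :
    intertwiner R i j c * R (base G n h) =
      R (base G n (fun l => h (Equiv.swap i j l))) * intertwiner R i j c := by
  rw [intertwiner_mul_rep R hij (Nat.zero_le _) (Nat.zero_le _) (base_mem_chainSubgroup 0 h),
    swapConj_base]

/-- $(s+cT)(s-cT)=1-c^2T^2$, because $s$ and $T$ commute and $s^2=1$. It makes $s-cT$ injective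
where $T^2$ is a scalar `μ` with $c^2\mu\ne1$. -/
theorem intertwiner_neg_mul (c : ℂ) (v : V) :
    intertwiner R i j (-c) (intertwiner R i j c v) = v - c ^ 2 • twist R i j (twist R i j v) := by
  have h : cox R i j (twist R i j v) = twist R i j (cox R i j v) :=
    LinearMap.congr_fun (cox_mul_twist R i j) v
  simp only [intertwiner_apply, map_sub, map_smul, h, cox_cox]
  module

variable {R}

theorem intertwiner_eq_zero {c μ : ℂ} {v : V} (hμ : twist R i j (twist R i j v) = μ • v)
    (hc : c ^ 2 * μ ≠ 1) (hv : intertwiner R i j c v = 0) : v = 0 := by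
  have h := intertwiner_neg_mul R (i := i) (j := j) c v
  rw [hv, map_zero, hμ, smul_smul] at h
  have h2 : (1 - c ^ 2 * μ) • v = 0 := by rw [sub_smul, one_smul, ← h]
  exact (smul_eq_zero.1 h2).resolve_left (sub_ne_zero.2 hc.symm)

theorem jm_twist {l : Fin n} {a : ℂ} {v : V} (hv : jm R l v = a • v) (i j : Fin n) :
    jm R l (twist R i j v) = a • twist R i j v := by
  have h := LinearMap.congr_fun (commute_twist_of_commute_base R (jm_commute_base R l) i j).eq v
  rwa [Module.End.mul_apply, Module.End.mul_apply, hv, map_smul] at h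

theorem jm_succ_cox (hij : (i : ℕ) + 1 = j) {a : ℂ} {v : V} (hv : jm R i v = a • v) :
    jm R j (cox R i j v) = a • cox R i j v + twist R i j v := by
  have h := LinearMap.congr_fun (jm_succ_mul_cox R hij) v
  simpa only [Module.End.mul_apply, LinearMap.add_apply, hv, map_smul] using h

theorem jm_cox (hij : (i : ℕ) + 1 = j) {b : ℂ} {v : V} (hv : jm R j v = b • v) :
    jm R i (cox R i j v) = b • cox R i j v - twist R i j v := by
  have h := LinearMap.congr_fun (jm_mul_cox R hij) v
  simpa only [Module.End.mul_apply, LinearMap.sub_apply, hv, map_smul] using h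

theorem classOp_cox (l : Fin n) (u : G) (v : V) :
    classOp R (Equiv.swap i j l) u (cox R i j v) = cox R i j (classOp R l u v) :=
  (LinearMap.congr_fun (perm_mul_classOp R (Equiv.swap i j) l u) v).symm

/-- The hypothesis `hc` covers both uses at once: $Tv=0$ with $c=0$, and $c=1/(\alpha_j-\alpha_i)$.
-/
theorem jm_intertwiner (hij : (i : ℕ) + 1 = j) {α : Fin n → ℂ} {c : ℂ} {v : V}
    (hv : ∀ l, jm R l v = α l • v) (hc : (c * (α j - α i)) • twist R i j v = twist R i j v)
    (l : Fin n) :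
    jm R l (intertwiner R i j c v) = α (Equiv.swap i j l) • intertwiner R i j c v := by
  simp only [intertwiner_apply, map_sub, map_smul, jm_twist (hv l)]
  rcases eq_or_ne l i with rfl | hi
  · rw [jm_cox hij (hv j), Equiv.swap_apply_left]
    linear_combination (norm := module) (1 : ℂ) • hc
  rcases eq_or_ne l j with rfl | hj
  · rw [jm_succ_cox hij (hv i), Equiv.swap_apply_right]
    linear_combination (norm := module) (-1 : ℂ) • hc
  · have h := LinearMap.congr_fun (jm_commute_cox R hij hi hj).eq v
    rw [Module.End.mul_apply, Module.End.mul_apply, hv l, map_smul] at h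
    rw [h, Equiv.swap_apply_of_ne_of_ne hi hj]
    module

theorem classOp_mul_intertwiner (R : Representation ℂ (Wreath G n) V) (hij : i ≠ j) (c : ℂ)
    (l : Fin n) (u : G) :
    classOp R l u * intertwiner R i j c =
      intertwiner R i j c * classOp R (Equiv.swap i j l) u := by
  simp only [classOp, Finset.sum_mul, Finset.mul_sum]
  refine Finset.sum_congr rfl fun g _ => ?_
  rw [intertwiner_mul_base R hij]
  congr 3
  funext m
  simp only [Pi.mulSingle_apply, Equiv.apply_eq_iff_eq]

/-- The image of `V^{ρ_1} ⊗ ⋯ ⊗ V^{ρ_n}` under an intertwining operator. -/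
def LabelIso.map {U : Submodule ℂ V} {ρ : Fin n → Dual G} (f : LabelIso R U ρ) (hij : i ≠ j)
    (c : ℂ) (hinj : ∀ v ∈ U, intertwiner R i j c v = 0 → v = 0) :
    LabelIso R (U.map (intertwiner R i j c)) (fun l => ρ (Equiv.swap i j l)) :=
  let e₁ : U ≃ₗ[ℂ] U.map (intertwiner R i j c) :=
    LinearEquiv.ofBijective ((intertwiner R i j c).submoduleMap U)
      ⟨(injective_iff_map_eq_zero _).2 fun v hv =>
        Subtype.ext (hinj v v.2 (congrArg Subtype.val hv)),
        LinearMap.submoduleMap_surjective _ U⟩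
  let e₂ : tensorSpace ρ ≃ₗ[ℂ] tensorSpace (fun l => ρ (Equiv.swap i j l)) :=
    PiTensorProduct.reindex ℂ (fun l => irrSpace (ρ l)) (Equiv.swap i j)
  { equiv := e₁.symm.trans (f.equiv.trans e₂)
    map_act := by
      intro h t
      have h1 : e₂.symm (tensorRep (fun l => ρ (Equiv.swap i j l)) h t) =
          tensorRep ρ (fun l => h (Equiv.swap i j l)) (e₂.symm t) := by
        have h2 := PiTensorProduct.map_reindex_symm (R := ℂ) (s := fun l => irrSpace (ρ l))
          (t := fun l => irrSpace (ρ l)) (fun l => irrRep (ρ l) (h (Equiv.swap i j l)))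
          (Equiv.swap i j) t
        refine Eq.trans ?_ h2.symm
        refine congrArg (fun A => e₂.symm (PiTensorProduct.map A t)) (funext fun l => ?_)
        change _ = irrRep (ρ (Equiv.swap i j l)) (h (Equiv.swap i j (Equiv.swap i j l)))
        rw [Equiv.swap_apply_self]
      have h2 := f.map_act (fun l => h (Equiv.swap i j l)) (e₂.symm t)
      have h3 := LinearMap.congr_fun
        (intertwiner_mul_base R hij c (fun l => h (Equiv.swap i j l))) (f.equiv.symm (e₂.symm t))
      simp only [Equiv.swap_apply_self, Module.End.mul_apply] at h3
      change intertwiner R i j c (f.equiv.symm (e₂.symm _)) =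
        R (base G n h) (intertwiner R i j c (f.equiv.symm (e₂.symm t)))
      rw [h1, h2, h3] }

end Intertwiner

/-! ### Gelfand-Tsetlin subspaces -/

section Gelfand

variable {G : Type*} [Group G] [Fintype G] {n : ℕ} {V : Type*} [AddCommGroup V] [Module ℂ V]
  {R : Representation ℂ (Wreath G n) V}

theorem chain_le {W : ℕ → Submodule ℂ V} (hW : ∀ m, 1 ≤ m → m < n → W m ≤ W (m + 1))
    {m m' : ℕ} (hm : 1 ≤ m) (hmm : m ≤ m') (hm' : m' ≤ n) : W m ≤ W m' := by
  induction m', hmm using Nat.le_induction with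
  | base => exact le_rfl
  | succ k hk ih => exact (ih (by omega)).trans (hW k (hm.trans hk) (by omega))

/-- The eigenvalues and the label of the image are direct computations; the work is the chain. The
scalar identities known on `U` first spread to the larger term `W₀`, by irreducibility, so that
$B=s_i-cT$ is injective there and maps each smaller term to an irreducible subspace. -/
theorem HasWeight.map_intertwiner [FiniteDimensional ℂ V] {α : Weight G n} {U : Submodule ℂ V}
    (hU : HasWeight R U α)
    {i j : Fin n} (hij : (i : ℕ) + 1 = j) {c μ : ℂ}
    (hc : ∀ v ∈ U, (c * (α.eig j - α.eig i)) • twist R i j v = twist R i j v)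
    (hμ : ∀ v ∈ U, twist R i j (twist R i j v) = μ • v) (hcμ : c ^ 2 * μ ≠ 1) :
    HasWeight R (U.map (intertwiner R i j c)) (α.swap i j) := by
  have hjn := j.isLt
  have hne : i ≠ j := fun h => by rw [h] at hij; omega
  obtain ⟨hGZ, ⟨f⟩, hX⟩ := hU
  have hinjU : ∀ v ∈ U, intertwiner R i j c v = 0 → v = 0 := fun v hv =>
    intertwiner_eq_zero (hμ v hv) hcμ
  refine ⟨?_, ⟨f.map hne c hinjU⟩, ?_⟩
  swap
  · rintro l _ ⟨v, hv, rfl⟩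
    exact jm_intertwiner hij (fun l => hX l v hv) (hc v hv) l
  obtain ⟨W, hWn, hW1, hWirr, hWle⟩ := (isGZSubspace_iff (by omega) R U).1 hGZ
  have hUirr : IsIrredOn R (chainSubgroup G n 1) U := hW1 ▸ hWirr 1 le_rfl (by omega)
  obtain ⟨u, hu, hu0⟩ := hUirr.exists_ne_zero
  -- the term of the chain on which `X_i`, `X_j` and `T²` act as scalars
  obtain ⟨W₀, hW₀, hUW₀, hW₀j, hleW₀⟩ : ∃ W₀, IsIrredOn R (chainSubgroup G n i) W₀ ∧ U ≤ W₀ ∧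
      W₀ ≤ W (j + 1) ∧ ∀ m, 1 ≤ m → m ≤ (i : ℕ) → W m ≤ W₀ := by
    -- For `i = 0` the chain has no term with index `i`; `U` takes its place because
    -- $H_{0,n}=H_{1,n}$.
    rcases Nat.eq_zero_or_pos (i : ℕ) with h0 | h0
    · refine ⟨U, ?_, le_rfl, ?_, fun m hm hm' => by omega⟩
      · rw [h0, chainSubgroup_zero_eq_one]
        exact hUirr
      · rw [← hW1]
        exact chain_le hWle le_rfl (by omega) (by omega)
    · refine ⟨W i, hWirr i h0 (by omega), ?_, chain_le hWle h0 (by omega) (by omega),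
        fun m hm hm' => chain_le hWle hm hm' (by omega)⟩
      rw [← hW1]
      exact chain_le hWle le_rfl h0 (by omega)
  have huW₀ : u ∈ W₀ := hUW₀ hu
  have hW₀jm : ∀ l : Fin n, (i : ℕ) ≤ l → ∀ w ∈ W₀, jm R l w = α.eig l • w := fun l hl =>
    hW₀.smul_of_commute (fun h hh => jm_commute_chain R hl hh) huW₀ hu0 (hX l u hu)
  have hW₀cl : ∀ (l : Fin n) (x : G), (i : ℕ) ≤ l → ∀ w ∈ W₀,
      classOp R l x w = labelChar (α.label l) x • w := fun l x hl =>
    hW₀.smul_of_commute (fun h hh => classOp_commute_chain R hl x hh) huW₀ hu0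
      (f.classOp_apply l x hu)
  have hW₀μ : ∀ w ∈ W₀, twist R i j (twist R i j w) = μ • w := by
    refine hW₀.smul_of_commute (A := twist R i j * twist R i j) (fun h hh => ?_) huW₀ hu0
      (hμ u hu)
    rw [Commute, SemiconjBy, mul_assoc, twist_mul_rep R hne le_rfl (by omega) hh, ← mul_assoc,
      twist_mul_rep R hne le_rfl (by omega) (swapConj_mem le_rfl (by omega) hh),
      swapConj_swapConj, mul_assoc]
  have hW₀c : ∀ w ∈ W₀, (c * (α.eig j - α.eig i)) • twist R i j w = twist R i j w := by
    have h := hW₀.le_ker (A := (c * (α.eig j - α.eig i)) • twist R i j - twist R i j)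
      (swapConj i j) (fun h hh => ?_) huW₀ hu0 ?_
    · exact fun w hw => sub_eq_zero.1 (h w hw)
    · rw [sub_mul (_ • _), mul_sub (R _), smul_mul_assoc, mul_smul_comm,
        twist_mul_rep R hne le_rfl (by omega) hh]
    · exact sub_eq_zero.2 (hc u hu)
  have hinj : ∀ w ∈ W₀, intertwiner R i j c w = 0 → w = 0 := fun w hw =>
    intertwiner_eq_zero (hW₀μ w hw) hcμ
  have hmap : ∀ m : ℕ, m ≤ (i : ℕ) → ∀ X ≤ W₀, IsIrredOn R (chainSubgroup G n m) X →
      IsIrredOn R (chainSubgroup G n m) (X.map (intertwiner R i j c)) := by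
    intro m hm X hXW hX
    have hm' : m ≤ (j : ℕ) := by omega
    refine hX.map (swapConj i j) (swapConj i j) (fun h hh => swapConj_mem hm hm' hh)
      (fun h hh => swapConj_mem hm hm' hh) (fun h hh => ?_) (fun h hh => ?_)
      (fun w hw => hinj w (hXW hw))
    · rw [intertwiner_mul_rep R hne hm hm' (swapConj_mem hm hm' hh), swapConj_swapConj]
    · rw [intertwiner_mul_rep R hne hm hm' hh]
  have hYirr := hWirr (j + 1) (by omega) (by omega)
  -- The new term at `j`: $B$ moves the eigenvalues at `i` to `j`, so `D` is cut out at `j` by the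
  -- data of `i` and contains the image of `W₀`.
  set D := jointEigen R (W (j + 1)) j (α.eig i) (labelChar (α.label i)) with hD
  have hBD : W₀.map (intertwiner R i j c) ≤ D := by
    rintro _ ⟨w, hw, rfl⟩
    refine ⟨?_, ?_, fun x => ?_⟩
    · have hw' := hW₀j hw
      rw [intertwiner_apply]
      exact sub_mem (cox_mem hYirr.stable (by omega) (by omega) hw')
        (Submodule.smul_mem _ _ (twist_mem hYirr.stable _ _ hw'))
    · rw [intertwiner_apply, map_sub, map_smul, jm_succ_cox hij (hW₀jm i le_rfl w hw),
        jm_twist (hW₀jm j (by omega) w hw)]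
      linear_combination (norm := module) (-1 : ℂ) • hW₀c w hw
    · have h1 : classOp R j x * intertwiner R i j c = intertwiner R i j c * classOp R i x := by
        have := classOp_mul_intertwiner R hne c j x
        rwa [Equiv.swap_apply_right] at this
      have h2 := LinearMap.congr_fun h1 w
      rwa [Module.End.mul_apply, Module.End.mul_apply, hW₀cl i x le_rfl w hw, map_smul] at h2
  have hDne : D ≠ ⊥ := by
    intro h0
    rw [h0, le_bot_iff] at hBD
    exact (hmap i le_rfl W₀ le_rfl hW₀).ne_bot hBD
  have hDirr : IsIrredOn R (chainSubgroup G n j) D := isIrredOn_jointEigen hij hYirr hDne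
  rw [isGZSubspace_iff (by omega)]
  refine ⟨fun m => if m ≤ (i : ℕ) then (W m).map (intertwiner R i j c) else
    if m = (j : ℕ) then D else W m, ?_, ?_, fun m hm hmn => ?_, fun m hm hmn => ?_⟩
  · dsimp only
    rw [if_neg (by omega), if_neg (by omega), hWn]
  · dsimp only
    rcases Nat.eq_zero_or_pos (i : ℕ) with h0 | h0
    · rw [if_neg (by omega), if_pos (by omega)]
      symm
      -- For `i = 0` the first term of the new chain is `D` itself; it is irreducible for $H_{1,n}$
      -- and contains the image of `U`, so the two agree.
      refine hDirr.eq_of_le _ ((Submodule.map_mono hUW₀).trans hBD) ?_ ?_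
      · rw [← hij, h0, zero_add, ← chainSubgroup_zero_eq_one]
        refine (hmap 0 (by omega) U hUW₀ ?_).stable
        rwa [chainSubgroup_zero_eq_one]
      · refine (hmap 0 (by omega) U hUW₀ ?_).ne_bot
        rwa [chainSubgroup_zero_eq_one]
    · rw [if_pos (by omega), hW1]
  · dsimp only
    split_ifs with h1 h2
    · exact hmap m h1 _ (hleW₀ m hm h1) (hWirr m hm hmn)
    · rw [h2]; exact hDirr
    · exact hWirr m hm hmn
  · dsimp only
    rcases lt_trichotomy m (i : ℕ) with h | h | h
    · rw [if_pos h.le, if_pos (by omega)]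
      exact Submodule.map_mono (hWle m hm hmn)
    · rw [if_pos h.le, if_neg (by omega), if_pos (by omega)]
      exact (Submodule.map_mono (hleW₀ m hm h.le)).trans hBD
    · rw [if_neg (by omega), if_neg (by omega : ¬ m + 1 ≤ (i : ℕ)),
        if_neg (by omega : ¬ m + 1 = (j : ℕ))]
      split_ifs with h2
      · rw [h2]
        exact fun y hy => hy.1
      · exact hWle m hm hmn

theorem HasWeight.isIrredOn (hn : 1 ≤ n) {α : Weight G n} {U : Submodule ℂ V}
    (hU : HasWeight R U α) : IsIrredOn R (chainSubgroup G n 1) U := by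
  obtain ⟨W, -, hW1, hWirr, -⟩ := (isGZSubspace_iff hn R U).1 hU.1
  exact hW1 ▸ hWirr 1 le_rfl hn

omit [Fintype G] in
theorem LabelIso.switchOn_switchOn {U : Submodule ℂ V} {ρ : Fin n → Dual G} (f : LabelIso R U ρ)
    {i j : Fin n} (h : ρ i = ρ j) (v : U) :
    f.switchOn i j h (f.switchOn i j h v) = v := by
  have hs : ∀ t, switch ρ i j h (switch ρ i j h t) = t := by
    intro t
    have h1 : (switch ρ i j h).toLinearMap ∘ₗ (switch ρ i j h).toLinearMap = LinearMap.id := by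
      refine PiTensorProduct.ext (MultilinearMap.ext fun v => ?_)
      simp only [LinearMap.compMultilinearMap_apply, LinearMap.comp_apply, LinearEquiv.coe_coe,
        switch_tprod, LinearMap.id_apply]
      refine congrArg (PiTensorProduct.tprod ℂ) (funext fun m => ?_)
      rw [irrCast_irrCast]
      exact irrCast_index ρ v (by simp) _ rfl
    exact LinearMap.congr_fun h1 t
  simp [LabelIso.switchOn, hs]

theorem LabelIso.twist_twist {U : Submodule ℂ V} {ρ : Fin n → Dual G} (f : LabelIso R U ρ)
    {i j : Fin n} (hij : i ≠ j) (h : ρ i = ρ j) {v : V} (hv : v ∈ U) :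
    twist R i j (twist R i j v) = (ratio (ρ i)) ^ 2 • v := by
  have h1 := f.twist_eq_switchOn hij h ⟨v, hv⟩
  have h2 := f.twist_eq_switchOn hij h (f.switchOn i j h ⟨v, hv⟩)
  rw [f.switchOn_switchOn h] at h2
  rw [h1, map_smul, h2, smul_smul, sq]

end Gelfand

/-! ### The separate claims about weights. -/

section Weights

variable {G : Type*} [Group G] [Fintype G] {n : ℕ} {V : Type*} [AddCommGroup V] [Module ℂ V]
  [FiniteDimensional ℂ V] {R : Representation ℂ (Wreath G n) V} {α : Weight G n}
  {U : Submodule ℂ V}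

theorem ne_of_succ_eq {i j : Fin n} (hij : (i : ℕ) + 1 = j) : i ≠ j := fun h => by
  rw [h] at hij; omega

theorem HasWeight.twist_ne_zero (hU : HasWeight R U α) {i j : Fin n} (hij : i ≠ j)
    (h : α.label i = α.label j) {v : V} (hv : v ∈ U) (hv0 : v ≠ 0) : twist R i j v ≠ 0 := by
  obtain ⟨-, ⟨f⟩, -⟩ := hU
  intro hT
  refine hv0 (twist_injective hij (fun u => f.classOp_apply i u hv) (fun u => ?_) hT)
  rw [f.classOp_apply j u hv, h]

theorem HasWeight.eig_ne (hn : 1 ≤ n) (hU : HasWeight R U α) {i j : Fin n}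
    (hij : (i : ℕ) + 1 = j) (h : α.label i = α.label j) : α.eig i ≠ α.eig j := by
  obtain ⟨v, hv, hv0⟩ := (hU.isIrredOn hn).exists_ne_zero
  intro he
  refine hU.twist_ne_zero (ne_of_succ_eq hij) h hv hv0
    (twist_eq_zero hij hv0 (hU.2.2 i v hv) ?_)
  rw [he]
  exact hU.2.2 j v hv

theorem HasWeight.cox_eq (hn : 1 ≤ n) (hU : HasWeight R U α) {i j : Fin n}
    (hij : (i : ℕ) + 1 = j) (h : α.label i = α.label j)
    (hr : (α.eig j - α.eig i) ^ 2 = ratio (α.label i) ^ 2) {v : V} (hv : v ∈ U) :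
    cox R i j v = (α.eig j - α.eig i)⁻¹ • twist R i j v := by
  rcases eq_or_ne v 0 with rfl | hv0
  · simp
  obtain ⟨f⟩ := hU.2.1
  exact sub_eq_zero.1 ((intertwiner_eq_zero_iff hij hv0 (hU.2.2 i v hv) (hU.2.2 j v hv)
    (sub_ne_zero.2 (hU.eig_ne hn hij h).symm) (f.twist_twist (ne_of_succ_eq hij) h hv)).2 hr)

theorem HasWeight.map_cox_eq_iff (hn : 1 ≤ n) (hU : HasWeight R U α) {i j : Fin n}
    (hij : (i : ℕ) + 1 = j) :
    U.map (cox R i j) = U ↔ α.label i = α.label j ∧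
      (α.eig j - α.eig i) ^ 2 = ratio (α.label i) ^ 2 := by
  have hne := ne_of_succ_eq hij
  have hst := (hU.isIrredOn hn).stable
  constructor
  · intro hmap
    obtain ⟨v, hv, hv0⟩ := (hU.isIrredOn hn).exists_ne_zero
    obtain ⟨f⟩ := hU.2.1
    have hsv : cox R i j v ∈ U := by
      rw [← hmap]
      exact ⟨v, hv, rfl⟩
    -- Since `U` is stable under $s_i$, conjugating shows that the class operators at `i` and `j`
    -- have the same eigenvalues on `v`, so the twist is injective there. Unequal labels would make
    -- it vanish, so no separation of irreducible modules by their characters is needed.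
    have hT : twist R i j v ≠ 0 := by
      intro hT
      refine hv0 (twist_injective hne (fun u => f.classOp_apply i u hv) (fun u => ?_) hT)
      have h1 := classOp_cox (R := R) (i := i) (j := j) j u v
      rw [Equiv.swap_apply_right, f.classOp_apply i u hsv, f.classOp_apply j u hv, map_smul] at h1
      have h2 := congrArg (cox R i j) h1
      rw [map_smul, map_smul, cox_cox] at h2
      rw [f.classOp_apply j u hv, h2]
    have hlab : α.label i = α.label j := by
      by_contra hlab
      exact hT (f.twist_eq_zero hlab hv)
    refine ⟨hlab, ?_⟩
    have hab := sub_ne_zero.2 (hU.eig_ne hn hij hlab).symm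
    rw [← intertwiner_eq_zero_iff hij hv0 (hU.2.2 i v hv) (hU.2.2 j v hv) hab
      (f.twist_twist hne hlab hv), sub_eq_zero]
    have h1 := jm_succ_cox hij (hU.2.2 i v hv)
    have h2 : jm R j (cox R i j v) = α.eig j • cox R i j v := hU.2.2 j _ hsv
    rw [h2] at h1
    rw [eq_inv_smul_iff₀ hab, sub_smul, h1, add_sub_cancel_left]
  · rintro ⟨hlab, hr⟩
    have hle : ∀ v ∈ U, cox R i j v ∈ U := fun v hv => by
      rw [hU.cox_eq hn hij hlab hr hv]
      exact U.smul_mem _ (twist_mem hst i j hv)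
    refine le_antisymm ?_ fun v hv => ⟨cox R i j v, hle v hv, cox_cox R i j v⟩
    rintro _ ⟨v, hv, rfl⟩
    exact hle v hv

/-- The braid relation forces equal differences. -/
theorem HasWeight.sub_eq_sub (hn : 1 ≤ n) (hU : HasWeight R U α) {i j k : Fin n}
    (hij : (i : ℕ) + 1 = j) (hjk : (j : ℕ) + 1 = k) (h : α.label i = α.label j)
    (h' : α.label j = α.label k) (hr : (α.eig j - α.eig i) ^ 2 = ratio (α.label i) ^ 2)
    (hr' : (α.eig k - α.eig j) ^ 2 = ratio (α.label j) ^ 2) :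
    α.eig j - α.eig i = α.eig k - α.eig j := by
  obtain ⟨v, hv, hv0⟩ := (hU.isIrredOn hn).exists_ne_zero
  have hst := (hU.isIrredOn hn).stable
  obtain ⟨f⟩ := hU.2.1
  have hne := ne_of_succ_eq hij
  have hne' := ne_of_succ_eq hjk
  have hik : i ≠ k := fun hik => by rw [hik] at hij; omega
  have hs : Equiv.swap i j k = k := Equiv.swap_apply_of_ne_of_ne hik.symm hne'.symm
  have hs' : Equiv.swap j k i = i := Equiv.swap_apply_of_ne_of_ne hne hik
  -- The twists satisfy the same conjugation relations as the transpositions, apart from $T^2=r^2$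
  -- in place of $s^2=1$.
  have hT : twist R i j * twist R j k = twist R i k * twist R i j := by
    rw [twist_mul_twist_swap R hne, Equiv.swap_apply_right, hs]
  have hT' : twist R j k * twist R i j = twist R i k * twist R j k := by
    rw [twist_mul_twist_swap R hne', Equiv.swap_apply_left, hs']
  have hC : cox R i j * cox R j k = cox R i k * cox R i j := by
    conv_lhs => rw [cox, perm_mul_cox, Equiv.swap_apply_right, hs]
    rfl
  have hC' : cox R j k * cox R i j = cox R i k * cox R j k := by
    conv_lhs => rw [cox, perm_mul_cox, Equiv.swap_apply_left, hs']
    rfl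
  have hi := fun {w : V} (hw : w ∈ U) => hU.cox_eq hn hij h hr hw
  have hj := fun {w : V} (hw : w ∈ U) => hU.cox_eq hn hjk h' hr' hw
  set c := (α.eig j - α.eig i)⁻¹ with hc
  set d := (α.eig k - α.eig j)⁻¹ with hd
  have hc0 : c ≠ 0 := inv_ne_zero (sub_ne_zero.2 (hU.eig_ne hn hij h).symm)
  have hd0 : d ≠ 0 := inv_ne_zero (sub_ne_zero.2 (hU.eig_ne hn hjk h').symm)
  have hr0 := pow_ne_zero 2 (ratio_ne_zero (α.label i))
  -- On `U` the transpositions are $cT_{ij}$ and $dT_{jk}$, so the two expressions of $(i,k)$ in the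
  -- braid relation give $c^2d\,r^2T_{ik}v=cd^2\,r^2T_{ik}v$ with $T_{ik}v\ne0$.
  have e1 : cox R i k v = (c * d * c * ratio (α.label i) ^ 2) • twist R i k v := by
    have h1 : cox R i k v = cox R i j (cox R j k (cox R i j v)) := by
      have := LinearMap.congr_fun hC (cox R i j v)
      rw [Module.End.mul_apply, Module.End.mul_apply, cox_cox] at this
      exact this.symm
    have h2 := LinearMap.congr_fun hT (twist R i j v)
    rw [Module.End.mul_apply, Module.End.mul_apply, f.twist_twist hne h hv, map_smul] at h2
    rw [h1, hi hv, map_smul, hj (twist_mem hst i j hv), map_smul, map_smul,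
      hi (twist_mem hst j k (twist_mem hst i j hv)), h2, smul_smul, smul_smul, smul_smul]
  have e2 : cox R i k v = (d * c * d * ratio (α.label i) ^ 2) • twist R i k v := by
    have h1 : cox R i k v = cox R j k (cox R i j (cox R j k v)) := by
      have := LinearMap.congr_fun hC' (cox R j k v)
      rw [Module.End.mul_apply, Module.End.mul_apply, cox_cox] at this
      exact this.symm
    have h2 := LinearMap.congr_fun hT' (twist R j k v)
    rw [Module.End.mul_apply, Module.End.mul_apply, f.twist_twist hne' h' hv, map_smul, ← h] at h2
    rw [h1, hj hv, map_smul, hi (twist_mem hst j k hv), map_smul, map_smul,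
      hj (twist_mem hst i j (twist_mem hst j k hv)), h2, smul_smul, smul_smul, smul_smul]
  have h3 := smul_left_injective ℂ (hU.twist_ne_zero hik (h.trans h') hv hv0) (e1.symm.trans e2)
  have h4 := mul_right_cancel₀ hr0 h3
  have h5 : c = d := mul_left_cancel₀ (mul_ne_zero hc0 hd0) (by linear_combination h4)
  exact inv_injective h5

theorem HasWeight.map_cox (hU : HasWeight R U α) {i j : Fin n}
    (hij : (i : ℕ) + 1 = j) (h : α.label i ≠ α.label j) :
    HasWeight R (U.map (cox R i j)) (α.swap i j) := by
  obtain ⟨f⟩ := hU.2.1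
  have h0 : ∀ v ∈ U, twist R i j v = 0 := fun v hv => f.twist_eq_zero h hv
  have h1 := hU.map_intertwiner hij (c := 0) (μ := 0) (fun v hv => by rw [h0 v hv, smul_zero])
    (fun v hv => by rw [h0 v hv, map_zero, zero_smul]) (by simp)
  rwa [intertwiner, zero_smul, sub_zero] at h1

theorem HasWeight.range_sub_switchOn (hn : 1 ≤ n) (hU : HasWeight R U α) {i j : Fin n}
    (hij : (i : ℕ) + 1 = j) (h : α.label i = α.label j)
    (hr : (α.eig j - α.eig i) ^ 2 ≠ ratio (α.label i) ^ 2) (f : LabelIso R U α.label) :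
    HasWeight R (LinearMap.range (cox R i j ∘ₗ U.subtype -
      (ratio (α.label i) / (α.eig j - α.eig i)) • (U.subtype ∘ₗ f.switchOn i j h)))
      (α.swap i j) := by
  have hne := ne_of_succ_eq hij
  have hab := sub_ne_zero.2 (hU.eig_ne hn hij h).symm
  have h1 := hU.map_intertwiner hij (c := (α.eig j - α.eig i)⁻¹)
    (fun v _ => by rw [inv_mul_cancel₀ hab, one_smul]) (fun v hv => f.twist_twist hne h hv)
    (by rw [inv_pow, ne_eq, inv_mul_eq_one₀ (pow_ne_zero 2 hab)]; exact hr)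
  have h2 : cox R i j ∘ₗ U.subtype -
      (ratio (α.label i) / (α.eig j - α.eig i)) • (U.subtype ∘ₗ f.switchOn i j h) =
      intertwiner R i j (α.eig j - α.eig i)⁻¹ ∘ₗ U.subtype := by
    refine LinearMap.ext fun v => ?_
    have h3 := f.twist_eq_switchOn hne h v
    simp only [LinearMap.sub_apply, LinearMap.smul_apply, LinearMap.comp_apply,
      Submodule.subtype_apply, intertwiner_apply, h3, smul_smul, div_eq_inv_mul]
  rwa [h2, LinearMap.range_comp, Submodule.range_subtype]

end Weights

end

end WreathGZ

theorem mainTheorem7 {G : Type*} [Group G] [Fintype G] {n : ℕ} (hn : 1 ≤ n)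
    {V : Type*} [AddCommGroup V] [Module ℂ V] [FiniteDimensional ℂ V]
    (R : Representation ℂ (WreathGZ.Wreath G n) V) (hR : R.IsIrreducible)
    (α : WreathGZ.Weight G n) (Vα : Submodule ℂ V) (hα : WreathGZ.HasWeight R Vα α) :
    -- (i)
    (∀ i j : Fin n, (i : ℕ) + 1 = (j : ℕ) →
      (Vα.map (WreathGZ.cox R i j) = Vα ↔
        α.label i = α.label j ∧
          (α.eig j = α.eig i + WreathGZ.ratio (α.label i) ∨
            α.eig j = α.eig i - WreathGZ.ratio (α.label i)))) ∧
    -- (ii)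
    (∀ i j : Fin n, (i : ℕ) + 1 = (j : ℕ) → ∀ h : α.label i = α.label j,
      ∀ f : WreathGZ.LabelIso R Vα α.label,
        (α.eig j = α.eig i + WreathGZ.ratio (α.label i) →
          ∀ v : Vα, WreathGZ.cox R i j (v : V) = (f.switchOn i j h v : V)) ∧
        (α.eig j = α.eig i - WreathGZ.ratio (α.label i) →
          ∀ v : Vα, WreathGZ.cox R i j (v : V) = -(f.switchOn i j h v : V))) ∧
    -- (iii)
    (∀ i j : Fin n, (i : ℕ) + 1 = (j : ℕ) → α.label i = α.label j → α.eig i ≠ α.eig j) ∧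
    -- (iv)
    (∀ i j k : Fin n, (i : ℕ) + 1 = (j : ℕ) → (j : ℕ) + 1 = (k : ℕ) →
      ¬ (α.label i = α.label j ∧ α.label j = α.label k ∧
          α.eig i = α.eig j + WreathGZ.ratio (α.label i) ∧
          α.eig j + WreathGZ.ratio (α.label i) = α.eig k) ∧
      ¬ (α.label i = α.label j ∧ α.label j = α.label k ∧
          α.eig i = α.eig j - WreathGZ.ratio (α.label i) ∧
          α.eig j - WreathGZ.ratio (α.label i) = α.eig k)) ∧
    -- (v)
    (∀ i j : Fin n, (i : ℕ) + 1 = (j : ℕ) → α.label i ≠ α.label j →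
      WreathGZ.HasWeight R (Vα.map (WreathGZ.cox R i j)) (α.swap i j)) ∧
    -- (vi)
    (∀ i j : Fin n, (i : ℕ) + 1 = (j : ℕ) → ∀ h : α.label i = α.label j,
      α.eig j ≠ α.eig i + WreathGZ.ratio (α.label i) →
      α.eig j ≠ α.eig i - WreathGZ.ratio (α.label i) →
      ∀ f : WreathGZ.LabelIso R Vα α.label,
        WreathGZ.HasWeight R
          (LinearMap.range
            (WreathGZ.cox R i j ∘ₗ Vα.subtype -
              (WreathGZ.ratio (α.label i) / (α.eig j - α.eig i)) •
                (Vα.subtype ∘ₗ f.switchOn i j h)))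
          (α.swap i j)) := by
  have hsq : ∀ x y r : ℂ, (y - x) ^ 2 = r ^ 2 ↔ y = x + r ∨ y = x - r := by
    intro x y r
    rw [sq_eq_sq_iff_eq_or_eq_neg, sub_eq_iff_eq_add', sub_eq_iff_eq_add', sub_eq_add_neg]
  refine ⟨fun i j hij => ?_, fun i j hij h f => ⟨fun he v => ?_, fun he v => ?_⟩,
    fun i j hij h => hα.eig_ne hn hij h, fun i j k hij hjk => ⟨?_, ?_⟩,
    fun i j hij h => hα.map_cox hij h, fun i j hij h h1 h2 f => ?_⟩
  · rw [hα.map_cox_eq_iff hn hij, hsq]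
  · have hr := WreathGZ.ratio_ne_zero (α.label i)
    rw [hα.cox_eq hn hij h ((hsq _ _ _).2 (Or.inl he)) v.2,
      f.twist_eq_switchOn (WreathGZ.ne_of_succ_eq hij) h, he, add_sub_cancel_left,
      inv_smul_smul₀ hr]
  · have hr := WreathGZ.ratio_ne_zero (α.label i)
    rw [hα.cox_eq hn hij h ((hsq _ _ _).2 (Or.inr he)) v.2,
      f.twist_eq_switchOn (WreathGZ.ne_of_succ_eq hij) h, he, sub_sub_cancel_left, inv_neg,
      neg_smul, inv_smul_smul₀ hr]
  · rintro ⟨h, h', e, e'⟩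
    -- The consecutive differences are $-r$ and $r$; equality would give $r=0$. In the second case
    -- the signs are reversed.
    have h1 := hα.sub_eq_sub hn hij hjk h h' (by rw [e]; ring) (by rw [← e', ← h]; ring)
    rw [e, ← e'] at h1
    refine WreathGZ.ratio_ne_zero (α.label i) ?_
    linear_combination (-1 / 2 : ℂ) * h1
  · rintro ⟨h, h', e, e'⟩
    have h1 := hα.sub_eq_sub hn hij hjk h h' (by rw [e]; ring) (by rw [← e', ← h]; ring)
    rw [e, ← e'] at h1
    refine WreathGZ.ratio_ne_zero (α.label i) ?_
    linear_combination (1 / 2 : ℂ) * h1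
  · exact hα.range_sub_switchOn hn hij h (fun h0 => ((hsq _ _ _).1 h0).elim h1 h2) f
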